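/- A chord diagram with $n$ chords is a perfect matching of $\{1,\dots,2n\}$; its pairs are called chords. The oriented intersection graph of a set of pairwise disjoint chords has the chords as vertices and an edge from $\{a,b\}$ to $\{c,d\}$ whenever $a<c<b<d$. The set of chords is connected if the underlying undirected graph is connected (and it is nonempty), and a chord of it is terminal if it has no outgoing edge in this graph. The root chord is the chord containing the smallest endpoint. The intersection order of a connected set of chords is defined recursively: the root chord comes first; then the root chord is removed, the connected components $C_1,\dots,C_s$ of what remains are ordered by their first (smallest) vertex, and after the root chord come all chords of $C_1$ in intersection order, then all chords of $C_2$ in intersection order, and so on. Theorem. For $n\ge 1$ let $f_n$ be the position (counted from $1$), in intersection order, of the first terminal chord of a uniformly distributed random connected chord diagram with $n$ chords. Then $$\mathbb{E}[f_n]\sim \frac{2n}{3}\qquad (n\to\infty).$$ -/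

import Mathlib

namespace ChordDiagrams

/-- `IsChordDiagram n C`: `C` is a perfect matching of `{1, …, 2n}`. An unordered pair `{a, b}` with
`a < b` is encoded as the ordered pair `(a, b)`. -/
def IsChordDiagram (n : ℕ) (C : Finset (ℕ × ℕ)) : Prop :=
  (∀ c ∈ C, c.1 < c.2 ∧ c.1 ∈ Finset.Icc 1 (2 * n) ∧ c.2 ∈ Finset.Icc 1 (2 * n)) ∧
    ∀ x ∈ Finset.Icc 1 (2 * n), ∃! c, c ∈ C ∧ (x = c.1 ∨ x = c.2)

/-- The oriented intersection graph of a set of chords `C`: an edge from `{a, b}` to `{c, d}`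
whenever `a < c < b < d`. -/
def orientedIntersectionGraph (C : Finset (ℕ × ℕ)) : Digraph C where
  Adj x y := x.1.1 < y.1.1 ∧ y.1.1 < x.1.2 ∧ x.1.2 < y.1.2

/-- The underlying undirected graph of the oriented intersection graph. -/
def intersectionGraph (C : Finset (ℕ × ℕ)) : SimpleGraph C :=
  (orientedIntersectionGraph C).toSimpleGraphInclusive

/-- A set of chords is connected if its intersection graph is connected
(in particular it is nonempty). -/
def IsConnected (C : Finset (ℕ × ℕ)) : Prop :=
  (intersectionGraph C).Connected

/-- A chord `c` of `C` is terminal if it has no outgoing edge in the oriented intersection graph. -/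
def IsTerminal (C : Finset (ℕ × ℕ)) (c : ℕ × ℕ) : Prop :=
  ∃ h : c ∈ C, ∀ d : C, ¬ (orientedIntersectionGraph C).Adj ⟨c, h⟩ d

/-- The root chord of a nonempty set of chords: the chord that contains the smallest endpoint
(the endpoint `1` for a chord diagram with at least one chord). -/
noncomputable def root (C : Finset (ℕ × ℕ)) (h : C.Nonempty) : ℕ × ℕ :=
  (C.exists_min_image Prod.fst h).choose

open Classical in
/-- The connected component of a chord `c` of `C`, as a set of chords. -/
noncomputable def component (C : Finset (ℕ × ℕ)) (c : C) : Finset (ℕ × ℕ) :=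
  ({d : C | (intersectionGraph C).Reachable c d} : Finset C).map (Function.Embedding.subtype _)

open Classical in
/-- The set of connected components of `C`. -/
noncomputable def components (C : Finset (ℕ × ℕ)) : Finset (Finset (ℕ × ℕ)) :=
  Finset.univ.image (component C)

/-- The first vertex (smallest endpoint) of a set of chords; it is `⊤` for the empty set. -/
def firstVertex (K : Finset (ℕ × ℕ)) : WithTop ℕ :=
  (K.image Prod.fst).min

/-- The list of connected components of `C`, ordered by their first vertex. -/
noncomputable def componentList (C : Finset (ℕ × ℕ)) : List (Finset (ℕ × ℕ)) :=
  (components C).toList.mergeSort (fun K L => decide (firstVertex K ≤ firstVertex L))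

theorem root_mem (C : Finset (ℕ × ℕ)) (h : C.Nonempty) : root C h ∈ C :=
  (C.exists_min_image Prod.fst h).choose_spec.1

theorem card_le_of_mem_componentList {C K : Finset (ℕ × ℕ)} (hK : K ∈ componentList C) :
    K.card ≤ C.card := by
  obtain ⟨c, -, rfl⟩ : ∃ c, c ∈ Finset.univ ∧ component C c = K := by
    simpa [componentList, components] using hK
  refine Finset.card_le_card fun d hd => ?_
  obtain ⟨e, -, rfl⟩ := Finset.mem_map.1 hd
  exact e.2

theorem card_lt_of_mem_componentList {C K : Finset (ℕ × ℕ)} (h : C.Nonempty)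
    (hK : K ∈ componentList (C.erase (root C h))) : K.card < C.card :=
  (card_le_of_mem_componentList hK).trans_lt (Finset.card_erase_lt_of_mem (root_mem C h))

open Classical in
/-- The chords of a connected set of chords `C` listed in intersection order: first the root chord,
then, after removal of the root chord, the chords of each connected component in turn (the
components ordered by first vertex), each component listed recursively in intersection order. -/
noncomputable def intersectionOrder (C : Finset (ℕ × ℕ)) : List (ℕ × ℕ) :=
  if h : C.Nonempty then
    root C h :: (componentList (C.erase (root C h))).attach.flatMap
      fun K => intersectionOrder K.1
  else []
termination_by C.card
decreasing_by exact card_lt_of_mem_componentList h K.2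

open Classical in
/-- The position (counted from `1`) in intersection order of the first terminal chord of `C`. -/
noncomputable def firstTerminalIndex (C : Finset (ℕ × ℕ)) : ℕ :=
  (intersectionOrder C).findIdx (fun c => decide (IsTerminal C c)) + 1

open Classical in
/-- The finite set of connected chord diagrams with `n` chords. -/
noncomputable def connectedChordDiagrams (n : ℕ) : Finset (Finset (ℕ × ℕ)) :=
  {C ∈ (Finset.Icc 1 (2 * n) ×ˢ Finset.Icc 1 (2 * n)).powerset | IsChordDiagram n C ∧ IsConnected C}

/-- The expected value of the position of the first terminal chord of a uniformly distributed
random connected chord diagram with `n` chords (`n ≥ 1`). -/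
noncomputable def expectedFirstTerminalIndex (n : ℕ) : ℝ :=
  (∑ C ∈ connectedChordDiagrams n, (firstTerminalIndex C : ℝ)) / (connectedChordDiagrams n).card

end ChordDiagrams

/-!
Let `K` be the first connected component that remains when the root chord is removed from a
connected diagram `C` with at least two chords. The root chord is not terminal, `K` is listed right
after it, and a chord of `K` is terminal in `K` exactly when it is terminal in `C`. So the index of
the first terminal chord of `C` exceeds that of `K` by one (`firstTerminalIndex_eq_add_one`).

The remaining chords `D = C \ K` form a connected diagram with the same root chord, and all their
vertices but the first lie in a single gap between consecutive vertices of `K`. Conversely, two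
connected diagrams with `k` and `m` chords can be combined in this way along each of the `2 * k - 1`
inner gaps of the first (`union_mem_connectedOn`, `exists_union_eq`). If `c n` is the number of
connected diagrams with `n` chords and `F n` the sum of their indices, this gives, for `n ≥ 2`,
`c n = ∑ (2 * k - 1) * c k * c m` and `F n = ∑ (2 * k - 1) * (F k + c k) * c m`, where the sums run
over `k + m = n`.

Symmetrization turns the first recurrence into `c n = (n - 1) * ∑ c k * c m`. It follows by
induction that `2 * n * c n ≤ c (n + 1) ≤ 2 * (n + 1) * c n` for `n ≥ 2`
(`IsConnectedCount.two_mul_le`, `IsConnectedCount.le_two_mul`): these bounds make `c k * c m`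
decrease towards the middle of the sum, so that the extreme terms dominate. By the same reasoning
the expected size `m` of the part outside `K` is `3 / 2 + O(1 / n)`: the value `m = 1` has
probability close to `1`, and `m = n - 1` has probability close to `1 / (2 * n)`
(`IsConnectedCount.abs_sub_drift_le`).

Each step of the recursion thus costs `3 / 2` chords on average. Precisely, the deviation of `F n`
from `2 * n / 3 * c n` satisfies the recurrence of `F` with an inhomogeneity `O(1 / n) * c n`. Since
the recursion passes through strictly decreasing sizes, the errors add up to at most a multiple of
the harmonic number of `n` (`IsConnectedCount.exists_abs_sub_le`), which is `o(n)`.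
-/

namespace ChordDiagrams

open Finset.HasAntidiagonal

/-! ### Connectedness through closed subsets -/

/-- The oriented edge relation of the intersection graph, on bare pairs. -/
def Crosses (c d : ℕ × ℕ) : Prop := c.1 < d.1 ∧ d.1 < c.2 ∧ c.2 < d.2

/-- Adjacency in the undirected intersection graph, on bare pairs. -/
def Meets (c d : ℕ × ℕ) : Prop := Crosses c d ∨ Crosses d c

theorem Meets.symm {c d : ℕ × ℕ} (h : Meets c d) : Meets d c := Or.symm h

/-- `T` is a union of connected components of `C`. -/
def IsClosedIn (C T : Finset (ℕ × ℕ)) : Prop :=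
  T ⊆ C ∧ ∀ c ∈ T, ∀ d ∈ C, Meets c d → d ∈ T

theorem intersectionGraph_adj {C : Finset (ℕ × ℕ)} (c d : C) :
    (intersectionGraph C).Adj c d ↔ Meets c.1 d.1 := by
  constructor
  · rintro ⟨-, h⟩
    exact h
  · intro h
    refine ⟨?_, h⟩
    rintro rfl
    rcases h with h | h <;> exact lt_irrefl _ h.1

theorem isTerminal_iff {C : Finset (ℕ × ℕ)} {c : ℕ × ℕ} :
    IsTerminal C c ↔ c ∈ C ∧ ∀ d ∈ C, ¬ Crosses c d := by
  constructor
  · rintro ⟨h, h'⟩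
    exact ⟨h, fun d hd => h' ⟨d, hd⟩⟩
  · rintro ⟨h, h'⟩
    exact ⟨h, fun d => h' d.1 d.2⟩

theorem mem_component {C : Finset (ℕ × ℕ)} {c : C} {d : ℕ × ℕ} :
    d ∈ component C c ↔ ∃ h : d ∈ C, (intersectionGraph C).Reachable c ⟨d, h⟩ := by
  simp [component]

theorem self_mem_component {C : Finset (ℕ × ℕ)} (c : C) : c.1 ∈ component C c :=
  mem_component.2 ⟨c.2, SimpleGraph.Reachable.refl _⟩

theorem isClosedIn_component {C : Finset (ℕ × ℕ)} (c : C) : IsClosedIn C (component C c) := by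
  refine ⟨fun d hd => (mem_component.1 hd).1, fun d hd e he hde => ?_⟩
  obtain ⟨h, hr⟩ := mem_component.1 hd
  exact mem_component.2
    ⟨he, hr.trans ((intersectionGraph_adj ⟨d, h⟩ ⟨e, he⟩).2 hde).reachable⟩

/-- A component is contained in every union of components that contains its base chord. -/
theorem component_subset_of_isClosedIn {C T : Finset (ℕ × ℕ)} (c : C) (hT : IsClosedIn C T)
    (hc : c.1 ∈ T) : component C c ⊆ T := by
  intro d hd
  obtain ⟨h, ⟨p⟩⟩ := mem_component.1 hd
  have key : ∀ {x y : C}, (intersectionGraph C).Walk x y → x.1 ∈ T → y.1 ∈ T := by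
    intro x y p
    induction p with
    | nil => exact id
    | cons hadj _ ih => exact fun hx => ih (hT.2 _ hx _ (Subtype.prop _)
        ((intersectionGraph_adj _ _).1 hadj))
  exact key p hc

theorem isConnected_iff {C : Finset (ℕ × ℕ)} :
    IsConnected C ↔ C.Nonempty ∧ ∀ T, IsClosedIn C T → T.Nonempty → T = C := by
  constructor
  · intro h
    obtain ⟨⟨c, hc⟩⟩ := h.nonempty
    refine ⟨⟨c, hc⟩, fun T hT ⟨t, ht⟩ => hT.1.antisymm fun d hd => ?_⟩
    exact component_subset_of_isClosedIn ⟨t, hT.1 ht⟩ hT ht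
      (mem_component.2 ⟨hd, h.preconnected _ _⟩)
  · rintro ⟨⟨c, hc⟩, h⟩
    have : Nonempty C := ⟨⟨c, hc⟩⟩
    refine SimpleGraph.Connected.mk fun x y => ?_
    have hx := h _ (isClosedIn_component x) ⟨_, self_mem_component x⟩
    exact (mem_component.1 (hx.symm ▸ y.2 : y.1 ∈ component C x)).2

theorem IsConnected.finset_nonempty {C : Finset (ℕ × ℕ)} (h : IsConnected C) : C.Nonempty :=
  (isConnected_iff.1 h).1

theorem IsConnected.eq_of_isClosedIn {C T : Finset (ℕ × ℕ)} (h : IsConnected C)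
    (hT : IsClosedIn C T) (hne : T.Nonempty) : T = C :=
  (isConnected_iff.1 h).2 T hT hne

theorem isConnected_component {C : Finset (ℕ × ℕ)} (c : C) : IsConnected (component C c) := by
  classical
  refine isConnected_iff.2 ⟨⟨_, self_mem_component c⟩, fun T hT ⟨t, ht⟩ => hT.1.antisymm ?_⟩
  have hsub : component C c ⊆ C := (isClosedIn_component c).1
  have hTC : IsClosedIn C T := ⟨hT.1.trans hsub, fun x hx d hd hxd =>
    hT.2 x hx d ((isClosedIn_component c).2 x (hT.1 hx) d hd hxd) hxd⟩
  -- The complement of `T` is closed as well, so the base chord cannot lie outside `T`.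
  by_cases hcT : c.1 ∈ T
  · exact component_subset_of_isClosedIn c hTC hcT
  · have hcompl : IsClosedIn C (C \ T) := by
      refine ⟨Finset.sdiff_subset, fun x hx d hd hxd => Finset.mem_sdiff.2 ⟨hd, fun hdT => ?_⟩⟩
      rw [Finset.mem_sdiff] at hx
      exact hx.2 (hTC.2 d hdT x hx.1 hxd.symm)
    have := component_subset_of_isClosedIn c hcompl (Finset.mem_sdiff.2 ⟨c.2, hcT⟩) (hT.1 ht)
    exact absurd ht (Finset.mem_sdiff.1 this).2

/-- Two connected unions of components with a common chord coincide. -/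
theorem IsClosedIn.eq_of_isConnected {C K L : Finset (ℕ × ℕ)} (hK : IsClosedIn C K)
    (hL : IsClosedIn C L) (hKc : IsConnected K) (hLc : IsConnected L) {e : ℕ × ℕ}
    (heK : e ∈ K) (heL : e ∈ L) : K = L := by
  have key : ∀ {K L : Finset (ℕ × ℕ)}, IsClosedIn C K → IsClosedIn C L → IsConnected K →
      e ∈ K → e ∈ L → K ⊆ L := by
    intro K L hK hL hKc heK heL
    have hcl : IsClosedIn K (K ∩ L) := ⟨Finset.inter_subset_left, fun x hx d hd hxd =>
      Finset.mem_inter.2 ⟨hd, hL.2 x (Finset.mem_inter.1 hx).2 d (hK.1 hd) hxd⟩⟩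
    exact Finset.inter_eq_left.1
      (hKc.eq_of_isClosedIn hcl ⟨e, Finset.mem_inter.2 ⟨heK, heL⟩⟩)
  exact (key hK hL hKc heK heL).antisymm (key hL hK hLc heL heK)

/-! ### Sets of pairwise disjoint chords -/

/-- A set of pairwise disjoint chords. -/
structure IsChordSet (C : Finset (ℕ × ℕ)) : Prop where
  lt : ∀ c ∈ C, c.1 < c.2
  eq_of_mem : ∀ c ∈ C, ∀ d ∈ C, ∀ x, (x = c.1 ∨ x = c.2) → (x = d.1 ∨ x = d.2) → c = d

theorem IsChordSet.mono {C D : Finset (ℕ × ℕ)} (h : IsChordSet C) (hDC : D ⊆ C) :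
    IsChordSet D :=
  ⟨fun c hc => h.lt c (hDC hc), fun c hc d hd => h.eq_of_mem c (hDC hc) d (hDC hd)⟩

theorem IsChordSet.eq_of_fst_eq {C : Finset (ℕ × ℕ)} (h : IsChordSet C) {c d : ℕ × ℕ}
    (hc : c ∈ C) (hd : d ∈ C) (hcd : c.1 = d.1) : c = d :=
  h.eq_of_mem c hc d hd c.1 (Or.inl rfl) (Or.inl hcd)

/-- `r` is the root chord of `C`. -/
def IsRoot (C : Finset (ℕ × ℕ)) (r : ℕ × ℕ) : Prop := r ∈ C ∧ ∀ c ∈ C, r.1 ≤ c.1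

theorem IsRoot.eq_root {C : Finset (ℕ × ℕ)} (hC : IsChordSet C) {r : ℕ × ℕ} (hr : IsRoot C r)
    (h : C.Nonempty) : root C h = r := by
  have hs := (C.exists_min_image Prod.fst h).choose_spec
  exact hC.eq_of_fst_eq hs.1 hr.1 (le_antisymm (hs.2 r hr.1) (hr.2 _ hs.1))

theorem isRoot_root (C : Finset (ℕ × ℕ)) (h : C.Nonempty) : IsRoot C (root C h) :=
  (C.exists_min_image Prod.fst h).choose_spec

/-- `K` is the first connected component left after the chord `r` is removed from `C`. -/
structure IsFirstComponent (C : Finset (ℕ × ℕ)) (r : ℕ × ℕ) (K : Finset (ℕ × ℕ)) : Prop where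
  closed : IsClosedIn (C.erase r) K
  connected : IsConnected K
  exists_isRoot : ∃ e ∈ K, IsRoot (C.erase r) e

theorem exists_isFirstComponent {C : Finset (ℕ × ℕ)} {r : ℕ × ℕ} (h : (C.erase r).Nonempty) :
    ∃ K, IsFirstComponent C r K :=
  ⟨component _ ⟨root _ h, root_mem _ h⟩, isClosedIn_component _, isConnected_component _,
    _, self_mem_component _, isRoot_root _ h⟩

theorem IsFirstComponent.unique {C K L : Finset (ℕ × ℕ)} {r : ℕ × ℕ} (hC : IsChordSet C)
    (hK : IsFirstComponent C r K) (hL : IsFirstComponent C r L) : K = L := by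
  obtain ⟨e, heK, he⟩ := hK.exists_isRoot
  obtain ⟨f, hfL, hf⟩ := hL.exists_isRoot
  have hef : e = f := (hC.mono (Finset.erase_subset r C)).eq_of_fst_eq he.1 hf.1
    (le_antisymm (he.2 f hf.1) (hf.2 e he.1))
  subst hef
  exact hK.closed.eq_of_isConnected hL.closed hK.connected hL.connected heK hfL

theorem IsFirstComponent.subset {C K : Finset (ℕ × ℕ)} {r : ℕ × ℕ}
    (hK : IsFirstComponent C r K) : K ⊆ C :=
  hK.closed.1.trans (Finset.erase_subset r C)

theorem IsFirstComponent.notMem {C K : Finset (ℕ × ℕ)} {r : ℕ × ℕ}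
    (hK : IsFirstComponent C r K) : r ∉ K :=
  fun h => Finset.notMem_erase r C (hK.closed.1 h)

/-! ### Recursion for the index of the first terminal chord -/

theorem mem_componentList {C L : Finset (ℕ × ℕ)} :
    L ∈ componentList C ↔ ∃ c, component C c = L := by
  simp [componentList, components]

theorem componentList_eq_cons {C K : Finset (ℕ × ℕ)} {r : ℕ × ℕ} (hC : IsChordSet C)
    (hK : IsFirstComponent C r K) : ∃ l, componentList (C.erase r) = K :: l := by
  classical
  have hsort : (componentList (C.erase r)).Pairwise
      (fun K L => decide (firstVertex K ≤ firstVertex L) = true) := by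
    apply List.pairwise_mergeSort
    · intro a b c hab hbc
      simp only [decide_eq_true_eq] at *
      exact hab.trans hbc
    · intro a b
      simpa using le_total _ _
  obtain ⟨e, heK, he⟩ := hK.exists_isRoot
  have hKe : component (C.erase r) ⟨e, he.1⟩ = K :=
    (isClosedIn_component _).eq_of_isConnected hK.closed (isConnected_component _) hK.connected
      (self_mem_component ⟨e, he.1⟩) heK
  have hKmem : K ∈ componentList (C.erase r) := mem_componentList.2 ⟨_, hKe⟩
  cases hl : componentList (C.erase r) with
  | nil => simp [hl] at hKmem
  | cons L l =>
    refine ⟨l, ?_⟩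
    obtain ⟨c, hc⟩ := mem_componentList.1
      (show L ∈ componentList (C.erase r) by simp [hl])
    have hLK : firstVertex L ≤ firstVertex K := by
      rw [hl] at hKmem hsort
      rcases List.mem_cons.1 hKmem with h | h
      · rw [h]
      · simpa using (List.pairwise_cons.1 hsort).1 K h
    have hle : firstVertex L ≤ (e.1 : WithTop ℕ) :=
      hLK.trans (Finset.min_le (Finset.mem_image_of_mem _ heK))
    have hLne : (L.image Prod.fst).Nonempty := by
      rw [← hc]
      exact ⟨_, Finset.mem_image_of_mem _ (self_mem_component c)⟩
    obtain ⟨a, ha⟩ := Finset.min_of_nonempty hLne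
    obtain ⟨f, hfL, hfa⟩ := Finset.mem_image.1 (Finset.mem_of_min ha)
    have hae : a ≤ e.1 := by
      rw [firstVertex, ha] at hle
      exact WithTop.coe_le_coe.1 hle
    have hLc : IsClosedIn (C.erase r) L := hc ▸ isClosedIn_component c
    have hfe : f = e := (hC.mono (Finset.erase_subset r C)).eq_of_fst_eq (hLc.1 hfL) he.1
      (le_antisymm (hfa ▸ hae) (he.2 f (hLc.1 hfL)))
    subst hfe
    rw [hLc.eq_of_isConnected hK.closed (hc ▸ isConnected_component c) hK.connected hfL heK]

theorem intersectionOrder_eq {C K : Finset (ℕ × ℕ)} {r : ℕ × ℕ} (hC : IsChordSet C)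
    (hr : IsRoot C r) (hK : IsFirstComponent C r K) :
    ∃ l, intersectionOrder C = r :: (intersectionOrder K ++ l) := by
  have hne : C.Nonempty := ⟨r, hr.1⟩
  obtain ⟨l, hl⟩ := componentList_eq_cons hC hK
  rw [intersectionOrder, dif_pos hne]
  have hroot := hr.eq_root hC hne
  have hflat : ((componentList (C.erase (root C hne))).attach.flatMap
      fun K => intersectionOrder K.1) =
      (componentList (C.erase (root C hne))).flatMap intersectionOrder := by
    rw [← List.flatMap_map (f := Subtype.val), List.attach_map_subtype_val]
  rw [hflat, hroot, hl, List.flatMap_cons]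
  exact ⟨_, rfl⟩

theorem mem_of_mem_intersectionOrder {C : Finset (ℕ × ℕ)} {c : ℕ × ℕ}
    (hc : c ∈ intersectionOrder C) : c ∈ C := by
  induction hn : C.card using Nat.strong_induction_on generalizing C with
  | _ n ih =>
    rw [intersectionOrder] at hc
    split_ifs at hc with h
    · rcases List.mem_cons.1 hc with rfl | hc
      · exact root_mem C h
      · obtain ⟨K, -, hcK⟩ := List.mem_flatMap.1 hc
        have hcK' := ih _ (hn ▸ card_lt_of_mem_componentList h K.2) hcK rfl
        obtain ⟨d, hd⟩ := mem_componentList.1 K.2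
        rw [← hd] at hcK'
        exact Finset.mem_of_mem_erase ((isClosedIn_component d).1 hcK')
    · simp at hc

theorem IsConnected.exists_crosses_root {C : Finset (ℕ × ℕ)} {r : ℕ × ℕ}
    (hconn : IsConnected C) (hr : IsRoot C r) (hne : (C.erase r).Nonempty) :
    ∃ d ∈ C.erase r, Crosses r d := by
  by_contra! hcon
  obtain ⟨d, hd⟩ := hne
  have hcl : IsClosedIn C {r} := by
    refine ⟨by simpa using hr.1, fun c hc e he hce => ?_⟩
    rw [Finset.mem_singleton] at hc ⊢
    subst hc
    by_contra hec
    rcases hce with h | h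
    · exact hcon _ (Finset.mem_erase.2 ⟨hec, he⟩) h
    · exact absurd (hr.2 _ he) (not_le.2 h.1)
  have := hconn.eq_of_isClosedIn hcl (Finset.singleton_nonempty r)
  rw [← this] at hd
  simp at hd

/-- Inside a component of `C` without its root, terminality does not depend on whether it is taken
in the component or in `C`: the only additional edges start at the root. -/
theorem IsFirstComponent.isTerminal_iff {C K : Finset (ℕ × ℕ)} {r c : ℕ × ℕ} (hr : IsRoot C r)
    (hK : IsFirstComponent C r K) (hc : c ∈ K) : IsTerminal C c ↔ IsTerminal K c := by
  rw [ChordDiagrams.isTerminal_iff, ChordDiagrams.isTerminal_iff]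
  constructor
  · exact fun h => ⟨hc, fun d hd => h.2 d (hK.subset hd)⟩
  · refine fun h => ⟨hK.subset hc, fun d hd hcd => h.2 d ?_ hcd⟩
    refine hK.closed.2 c hc d (Finset.mem_erase.2 ⟨?_, hd⟩) (Or.inl hcd)
    rintro rfl
    exact absurd (hr.2 c (hK.subset hc)) (not_le.2 hcd.1)

theorem exists_mem_intersectionOrder_isTerminal {C : Finset (ℕ × ℕ)} (hC : IsChordSet C)
    (hconn : IsConnected C) : ∃ c ∈ intersectionOrder C, IsTerminal C c := by
  induction hn : C.card using Nat.strong_induction_on generalizing C with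
  | _ n ih =>
    have hne := hconn.finset_nonempty
    have hr := isRoot_root C hne
    rcases (C.erase (root C hne)).eq_empty_or_nonempty with h | h
    · refine ⟨root C hne, by rw [intersectionOrder, dif_pos hne]; simp, ?_⟩
      rw [isTerminal_iff]
      refine ⟨hr.1, fun d hd hcr => ?_⟩
      by_cases hdr : d = root C hne
      · exact lt_irrefl _ (hdr ▸ hcr).1
      · have : d ∈ C.erase (root C hne) := Finset.mem_erase.2 ⟨hdr, hd⟩
        simp [h] at this
    · obtain ⟨K, hK⟩ := exists_isFirstComponent h
      have hlt : K.card < C.card := (Finset.card_le_card hK.closed.1).trans_lt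
        (Finset.card_erase_lt_of_mem hr.1)
      obtain ⟨c, hc, hct⟩ := ih _ (hn ▸ hlt) (hC.mono hK.subset) hK.connected rfl
      obtain ⟨l, hl⟩ := intersectionOrder_eq hC hr hK
      exact ⟨c, by simp [hl, hc], (hK.isTerminal_iff hr (mem_of_mem_intersectionOrder hc)).2 hct⟩

theorem firstTerminalIndex_eq_add_one {C K : Finset (ℕ × ℕ)} {r : ℕ × ℕ} (hC : IsChordSet C)
    (hconn : IsConnected C) (hr : IsRoot C r) (hK : IsFirstComponent C r K) :
    firstTerminalIndex C = firstTerminalIndex K + 1 := by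
  classical
  obtain ⟨l, hl⟩ := intersectionOrder_eq hC hr hK
  have hrt : ¬ IsTerminal C r := by
    intro h
    rw [isTerminal_iff] at h
    obtain ⟨e, he, hre⟩ := hconn.exists_crosses_root hr
      (hK.connected.finset_nonempty.mono hK.closed.1)
    exact h.2 e (Finset.mem_of_mem_erase he) hre
  obtain ⟨c, hc, hct⟩ := exists_mem_intersectionOrder_isTerminal (hC.mono hK.subset) hK.connected
  have hcongr : ∀ l' : List (ℕ × ℕ), (∀ c ∈ l', c ∈ K) →
      l'.findIdx (fun c => decide (IsTerminal C c)) =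
        l'.findIdx (fun c => decide (IsTerminal K c)) := by
    intro l'
    induction l' with
    | nil => simp
    | cons a l' ih =>
      intro h
      have ha := hK.isTerminal_iff hr (h a (by simp))
      rw [List.findIdx_cons, List.findIdx_cons, ih fun c hc => h c (by simp [hc])]
      simp only [ha]
  have hK' := hcongr (intersectionOrder K) fun _ => mem_of_mem_intersectionOrder
  have hlt : (intersectionOrder K).findIdx (fun c => decide (IsTerminal C c)) <
      (intersectionOrder K).length :=
    List.findIdx_lt_length_of_exists ⟨c, hc, by
      simpa using (hK.isTerminal_iff hr (mem_of_mem_intersectionOrder hc)).2 hct⟩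
  rw [firstTerminalIndex, firstTerminalIndex, hl, List.findIdx_cons]
  simp only [hrt, decide_false, cond_false]
  rw [List.findIdx_append, if_pos hlt, hK']

theorem firstTerminalIndex_singleton (c : ℕ × ℕ) : firstTerminalIndex {c} = 1 := by
  have hne : ({c} : Finset (ℕ × ℕ)).Nonempty := Finset.singleton_nonempty c
  have hroot : root {c} hne = c := by simpa using root_mem {c} hne
  have ht : IsTerminal {c} c := by
    rw [isTerminal_iff]
    refine ⟨by simp, fun d hd hcd => ?_⟩
    rw [Finset.mem_singleton] at hd
    exact lt_irrefl _ (hd ▸ hcd).1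
  rw [firstTerminalIndex, intersectionOrder, dif_pos hne, hroot, List.findIdx_cons]
  simp [ht]

/-! ### Connected sets of chords on a prescribed vertex set -/

/-- The set of endpoints of the chords of `C`. -/
def verts (C : Finset (ℕ × ℕ)) : Finset ℕ := C.image Prod.fst ∪ C.image Prod.snd

theorem mem_verts {C : Finset (ℕ × ℕ)} {x : ℕ} :
    x ∈ verts C ↔ ∃ c ∈ C, x = c.1 ∨ x = c.2 := by
  simp only [verts, Finset.mem_union, Finset.mem_image]
  constructor
  · rintro (⟨c, hc, rfl⟩ | ⟨c, hc, rfl⟩)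
    · exact ⟨c, hc, Or.inl rfl⟩
    · exact ⟨c, hc, Or.inr rfl⟩
  · rintro ⟨c, hc, rfl | rfl⟩
    · exact Or.inl ⟨c, hc, rfl⟩
    · exact Or.inr ⟨c, hc, rfl⟩

theorem fst_mem_verts {C : Finset (ℕ × ℕ)} {c : ℕ × ℕ} (hc : c ∈ C) : c.1 ∈ verts C :=
  mem_verts.2 ⟨c, hc, Or.inl rfl⟩

theorem snd_mem_verts {C : Finset (ℕ × ℕ)} {c : ℕ × ℕ} (hc : c ∈ C) : c.2 ∈ verts C :=
  mem_verts.2 ⟨c, hc, Or.inr rfl⟩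

theorem verts_union (C D : Finset (ℕ × ℕ)) : verts (C ∪ D) = verts C ∪ verts D := by
  ext x
  simp only [mem_verts, Finset.mem_union, or_and_right, exists_or]

theorem IsChordSet.card_verts {C : Finset (ℕ × ℕ)} (hC : IsChordSet C) :
    (verts C).card = 2 * C.card := by
  have hdisj : Disjoint (C.image Prod.fst) (C.image Prod.snd) := by
    rw [Finset.disjoint_left]
    intro x hx hx'
    obtain ⟨c, hc, rfl⟩ := Finset.mem_image.1 hx
    obtain ⟨d, hd, hdc⟩ := Finset.mem_image.1 hx'
    have := hC.eq_of_mem c hc d hd c.1 (Or.inl rfl) (Or.inr hdc.symm)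
    subst this
    exact (hC.lt c hc).ne' hdc
  rw [verts, Finset.card_union_of_disjoint hdisj, Finset.card_image_of_injOn,
    Finset.card_image_of_injOn, two_mul]
  · exact fun c hc d hd h => hC.eq_of_mem c hc d hd c.2 (Or.inr rfl) (Or.inr h)
  · exact fun c hc d hd h => hC.eq_of_fst_eq hc hd h

theorem IsChordSet.union {C D : Finset (ℕ × ℕ)} (hC : IsChordSet C) (hD : IsChordSet D)
    (h : Disjoint (verts C) (verts D)) : IsChordSet (C ∪ D) := by
  rw [Finset.disjoint_left] at h
  refine ⟨fun c hc => (Finset.mem_union.1 hc).elim (hC.lt c) (hD.lt c), ?_⟩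
  intro c hc d hd x hxc hxd
  rcases Finset.mem_union.1 hc with hc | hc <;> rcases Finset.mem_union.1 hd with hd | hd
  · exact hC.eq_of_mem c hc d hd x hxc hxd
  · exact absurd (mem_verts.2 ⟨d, hd, hxd⟩) (h (mem_verts.2 ⟨c, hc, hxc⟩))
  · exact absurd (mem_verts.2 ⟨c, hc, hxc⟩) (h (mem_verts.2 ⟨d, hd, hxd⟩))
  · exact hD.eq_of_mem c hc d hd x hxc hxd

open Classical in
/-- The connected sets of pairwise disjoint chords with vertex set `S`. -/
noncomputable def connectedOn (S : Finset ℕ) : Finset (Finset (ℕ × ℕ)) :=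
  {C ∈ (S ×ˢ S).powerset | IsChordSet C ∧ verts C = S ∧ IsConnected C}

theorem mem_connectedOn {S : Finset ℕ} {C : Finset (ℕ × ℕ)} :
    C ∈ connectedOn S ↔ IsChordSet C ∧ verts C = S ∧ IsConnected C := by
  simp only [connectedOn, Finset.mem_filter, Finset.mem_powerset, and_iff_right_iff_imp]
  rintro ⟨-, rfl, -⟩ c hc
  exact Finset.mem_product.2 ⟨fst_mem_verts hc, snd_mem_verts hc⟩

theorem isChordDiagram_iff {n : ℕ} {C : Finset (ℕ × ℕ)} :
    IsChordDiagram n C ↔ IsChordSet C ∧ verts C = Finset.Icc 1 (2 * n) := by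
  constructor
  · rintro ⟨h1, h2⟩
    have hv : verts C ⊆ Finset.Icc 1 (2 * n) := by
      intro x hx
      obtain ⟨c, hc, rfl | rfl⟩ := mem_verts.1 hx
      exacts [(h1 c hc).2.1, (h1 c hc).2.2]
    refine ⟨⟨fun c hc => (h1 c hc).1, fun c hc d hd x hxc hxd => ?_⟩, hv.antisymm fun x hx => ?_⟩
    · exact (h2 x (hv (mem_verts.2 ⟨c, hc, hxc⟩))).unique ⟨hc, hxc⟩ ⟨hd, hxd⟩
    · obtain ⟨c, ⟨hc, hxc⟩, -⟩ := h2 x hx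
      exact mem_verts.2 ⟨c, hc, hxc⟩
  · rintro ⟨hC, hv⟩
    refine ⟨fun c hc => ⟨hC.lt c hc, hv ▸ fst_mem_verts hc, hv ▸ snd_mem_verts hc⟩, fun x hx => ?_⟩
    obtain ⟨c, hc, hxc⟩ := mem_verts.1 (hv.symm ▸ hx)
    exact ⟨c, ⟨hc, hxc⟩, fun d hd => hC.eq_of_mem d hd.1 c hc x hd.2 hxc⟩

theorem connectedChordDiagrams_eq (n : ℕ) :
    connectedChordDiagrams n = connectedOn (Finset.Icc 1 (2 * n)) := by
  classical
  ext C
  rw [connectedChordDiagrams, connectedOn, Finset.mem_filter, Finset.mem_filter,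
    isChordDiagram_iff, and_assoc]

/-! ### Relabelling of vertices -/

/-- The set of chords obtained from `C` by renaming every vertex `x` to `φ x`. -/
def relabel (φ : ℕ → ℕ) (C : Finset (ℕ × ℕ)) : Finset (ℕ × ℕ) := C.image (Prod.map φ φ)

section Relabel

variable {φ : ℕ → ℕ}

theorem injective_prodMap (hφ : StrictMono φ) : Function.Injective (Prod.map φ φ) :=
  hφ.injective.prodMap hφ.injective

theorem injective_relabel (hφ : StrictMono φ) : Function.Injective (relabel φ) :=
  Finset.image_injective (injective_prodMap hφ)

theorem crosses_map_iff (hφ : StrictMono φ) {c d : ℕ × ℕ} :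
    Crosses (Prod.map φ φ c) (Prod.map φ φ d) ↔ Crosses c d := by
  simp only [Crosses, Prod.map_fst, Prod.map_snd, hφ.lt_iff_lt]

theorem meets_map_iff (hφ : StrictMono φ) {c d : ℕ × ℕ} :
    Meets (Prod.map φ φ c) (Prod.map φ φ d) ↔ Meets c d := by
  simp only [Meets, crosses_map_iff hφ]

theorem isChordSet_relabel_iff (hφ : StrictMono φ) {C : Finset (ℕ × ℕ)} :
    IsChordSet (relabel φ C) ↔ IsChordSet C := by
  constructor
  · intro h
    refine ⟨fun c hc => hφ.lt_iff_lt.1 (h.lt _ (Finset.mem_image_of_mem _ hc)), ?_⟩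
    intro c hc d hd x hxc hxd
    exact injective_prodMap hφ (h.eq_of_mem _ (Finset.mem_image_of_mem _ hc) _
      (Finset.mem_image_of_mem _ hd) (φ x) (hxc.imp (congrArg φ) (congrArg φ))
      (hxd.imp (congrArg φ) (congrArg φ)))
  · intro h
    constructor
    · intro c hc
      obtain ⟨c, hc', rfl⟩ := Finset.mem_image.1 hc
      exact hφ (h.lt c hc')
    · intro c hc d hd x hxc hxd
      obtain ⟨c, hc', rfl⟩ := Finset.mem_image.1 hc
      obtain ⟨d, hd', rfl⟩ := Finset.mem_image.1 hd
      obtain ⟨y, rfl⟩ : ∃ y, φ y = x := by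
        rcases hxc with rfl | rfl
        exacts [⟨_, rfl⟩, ⟨_, rfl⟩]
      rw [h.eq_of_mem c hc' d hd' y (hxc.imp (hφ.injective ·) (hφ.injective ·))
        (hxd.imp (hφ.injective ·) (hφ.injective ·))]

theorem verts_relabel (φ : ℕ → ℕ) (C : Finset (ℕ × ℕ)) :
    verts (relabel φ C) = (verts C).image φ := by
  simp only [verts, relabel, Finset.image_union, Finset.image_image]
  rfl

theorem isClosedIn_relabel_iff (hφ : StrictMono φ) {C T : Finset (ℕ × ℕ)} :
    IsClosedIn (relabel φ C) (relabel φ T) ↔ IsClosedIn C T := by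
  have hmem : ∀ {D : Finset (ℕ × ℕ)} {c}, Prod.map φ φ c ∈ relabel φ D ↔ c ∈ D := fun {D c} =>
    (injective_prodMap hφ).mem_finset_image
  constructor
  · rintro ⟨h1, h2⟩
    refine ⟨fun c hc => hmem.1 (h1 (hmem.2 hc)), fun c hc d hd hcd => ?_⟩
    exact hmem.1 (h2 _ (hmem.2 hc) _ (hmem.2 hd) ((meets_map_iff hφ).2 hcd))
  · rintro ⟨h1, h2⟩
    refine ⟨Finset.image_subset_image h1, fun c hc d hd hcd => ?_⟩
    obtain ⟨c, hc', rfl⟩ := Finset.mem_image.1 hc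
    obtain ⟨d, -, rfl⟩ := Finset.mem_image.1 hd
    exact hmem.2 (h2 c hc' d (hmem.1 hd) ((meets_map_iff hφ).1 hcd))

theorem isConnected_relabel_iff (hφ : StrictMono φ) {C : Finset (ℕ × ℕ)} :
    IsConnected (relabel φ C) ↔ IsConnected C := by
  simp only [isConnected_iff]
  refine and_congr Finset.image_nonempty ⟨fun h T hT hne => ?_, fun h T hT hne => ?_⟩
  · exact injective_relabel hφ (h _ ((isClosedIn_relabel_iff hφ).2 hT) (hne.image _))
  · obtain ⟨T, -, rfl⟩ := Finset.subset_image_iff.1 hT.1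
    exact congrArg (relabel φ)
      (h T ((isClosedIn_relabel_iff hφ).1 hT) (Finset.image_nonempty.1 hne))

theorem IsRoot.relabel (hφ : StrictMono φ) {C : Finset (ℕ × ℕ)} {r : ℕ × ℕ} (hr : IsRoot C r) :
    IsRoot (relabel φ C) (Prod.map φ φ r) := by
  refine ⟨Finset.mem_image_of_mem _ hr.1, fun c hc => ?_⟩
  obtain ⟨c, hc', rfl⟩ := Finset.mem_image.1 hc
  exact hφ.monotone (hr.2 c hc')

theorem relabel_erase (hφ : StrictMono φ) (C : Finset (ℕ × ℕ)) (r : ℕ × ℕ) :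
    relabel φ (C.erase r) = (relabel φ C).erase (Prod.map φ φ r) :=
  Finset.image_erase (injective_prodMap hφ) C r

theorem firstTerminalIndex_relabel (hφ : StrictMono φ) {C : Finset (ℕ × ℕ)} (hC : IsChordSet C)
    (hconn : IsConnected C) : firstTerminalIndex (relabel φ C) = firstTerminalIndex C := by
  induction hn : C.card using Nat.strong_induction_on generalizing C with
  | _ n ih =>
    obtain ⟨r, hr⟩ : ∃ r, IsRoot C r := ⟨_, isRoot_root C hconn.finset_nonempty⟩
    rcases (C.erase r).eq_empty_or_nonempty with h | h
    · obtain rfl : C = {r} := by rw [← Finset.insert_erase hr.1, h]; rfl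
      rw [relabel, Finset.image_singleton, firstTerminalIndex_singleton,
        firstTerminalIndex_singleton]
    · obtain ⟨K, hK⟩ := exists_isFirstComponent h
      have hK' : IsFirstComponent (relabel φ C) (Prod.map φ φ r) (relabel φ K) := by
        refine ⟨?_, (isConnected_relabel_iff hφ).2 hK.connected, ?_⟩
        · rw [← relabel_erase hφ]
          exact (isClosedIn_relabel_iff hφ).2 hK.closed
        · rw [← relabel_erase hφ]
          obtain ⟨e, heK, he⟩ := hK.exists_isRoot
          exact ⟨_, Finset.mem_image_of_mem _ heK, he.relabel hφ⟩
      have hlt : K.card < C.card := (Finset.card_le_card hK.closed.1).trans_lt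
        (Finset.card_erase_lt_of_mem hr.1)
      rw [firstTerminalIndex_eq_add_one hC hconn hr hK,
        firstTerminalIndex_eq_add_one ((isChordSet_relabel_iff hφ).2 hC)
          ((isConnected_relabel_iff hφ).2 hconn) (hr.relabel hφ) hK',
        ih _ (hn ▸ hlt) (hC.mono hK.subset) hK.connected rfl]

theorem connectedOn_image (hφ : StrictMono φ) (S : Finset ℕ) :
    connectedOn (S.image φ) = (connectedOn S).image (relabel φ) := by
  ext C
  simp only [Finset.mem_image, mem_connectedOn]
  constructor
  · rintro ⟨hC, hv, hconn⟩
    have hsub : C ⊆ (S ×ˢ S).image (Prod.map φ φ) := by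
      intro c hc
      have h1 := fst_mem_verts hc
      have h2 := snd_mem_verts hc
      rw [hv, Finset.mem_image] at h1 h2
      obtain ⟨a, ha, hac⟩ := h1
      obtain ⟨b, hb, hbc⟩ := h2
      exact Finset.mem_image.2 ⟨(a, b), Finset.mem_product.2 ⟨ha, hb⟩, Prod.ext hac hbc⟩
    obtain ⟨C, -, rfl⟩ := Finset.subset_image_iff.1 hsub
    refine ⟨C, ⟨(isChordSet_relabel_iff hφ).1 hC, ?_, (isConnected_relabel_iff hφ).1 hconn⟩, rfl⟩
    exact Finset.image_injective hφ.injective ((verts_relabel φ C).symm.trans hv)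
  · rintro ⟨C, ⟨hC, hv, hconn⟩, rfl⟩
    exact ⟨(isChordSet_relabel_iff hφ).2 hC, by rw [verts_relabel, hv],
      (isConnected_relabel_iff hφ).2 hconn⟩

theorem sum_connectedOn_image (hφ : StrictMono φ) (S : Finset ℕ) (g : Finset (ℕ × ℕ) → ℕ) :
    ∑ C ∈ connectedOn (S.image φ), g C = ∑ C ∈ connectedOn S, g (relabel φ C) := by
  rw [connectedOn_image hφ, Finset.sum_image]
  exact (injective_relabel hφ).injOn

theorem card_connectedOn_image (hφ : StrictMono φ) (S : Finset ℕ) :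
    (connectedOn (S.image φ)).card = (connectedOn S).card := by
  rw [connectedOn_image hφ, Finset.card_image_of_injective _ (injective_relabel hφ)]

theorem sum_firstTerminalIndex_connectedOn_image (hφ : StrictMono φ) (S : Finset ℕ) :
    ∑ C ∈ connectedOn (S.image φ), firstTerminalIndex C =
      ∑ C ∈ connectedOn S, firstTerminalIndex C := by
  rw [sum_connectedOn_image hφ]
  refine Finset.sum_congr rfl fun C hC => ?_
  rw [mem_connectedOn] at hC
  exact firstTerminalIndex_relabel hφ hC.1 hC.2.2

end Relabel

/-! ### Splitting a connected diagram at its first component -/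

/-- The increasing labelling by which the first component, a diagram with `2 * k` vertices, sits in
the whole diagram: vertex `1` of the latter is left free for the root chord, and so is a gap for the
`2 * m - 1` further vertices outside the component, between its `j`-th and its `(j + 1)`-st
vertex. For `m = 0` the truncated subtraction still gives an increasing map. -/
def outerLabel (m j x : ℕ) : ℕ := if x ≤ j then x + 1 else x + (2 * m - 1) + 1

/-- The increasing labelling by which the part outside the first component sits in the whole
diagram: all its vertices but the first are moved into the gap after the `j`-th vertex of the first
component. -/
def innerLabel (j y : ℕ) : ℕ := if y ≤ 1 then y else y + j

theorem strictMono_outerLabel (m j : ℕ) : StrictMono (outerLabel m j) := by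
  intro x y h
  unfold outerLabel
  split_ifs <;> omega

theorem strictMono_innerLabel (j : ℕ) : StrictMono (innerLabel j) := by
  intro x y h
  unfold innerLabel
  split_ifs <;> omega

/-- The vertex set of a first component with `k` chords. -/
def outer (k m j : ℕ) : Finset ℕ := (Finset.Icc 1 (2 * k)).image (outerLabel m j)

/-- The vertex set of the `m` chords outside the first component. -/
def inner (m j : ℕ) : Finset ℕ := (Finset.Icc 1 (2 * m)).image (innerLabel j)

theorem mem_outer {k m j x : ℕ} (hm : 1 ≤ m) (hj : j ≤ 2 * k) :
    x ∈ outer k m j ↔ (2 ≤ x ∧ x ≤ j + 1) ∨ (j + 2 * m + 1 ≤ x ∧ x ≤ 2 * (k + m)) := by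
  simp only [outer, outerLabel, Finset.mem_image, Finset.mem_Icc]
  constructor
  · rintro ⟨a, ha, rfl⟩
    split_ifs <;> omega
  · rintro (h | h)
    · exact ⟨x - 1, by omega, by rw [if_pos (by omega)]; omega⟩
    · exact ⟨x - 2 * m, by omega, by rw [if_neg (by omega)]; omega⟩

theorem mem_inner {m j x : ℕ} (hm : 1 ≤ m) :
    x ∈ inner m j ↔ x = 1 ∨ (j + 2 ≤ x ∧ x ≤ j + 2 * m) := by
  simp only [inner, innerLabel, Finset.mem_image, Finset.mem_Icc]
  constructor
  · rintro ⟨a, ha, rfl⟩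
    split_ifs <;> omega
  · rintro (h | h)
    · exact ⟨1, by omega, by simp [h]⟩
    · exact ⟨x - j, by omega, by rw [if_neg (by omega)]; omega⟩

theorem one_le_of_mem_connectedOn_inner {m j : ℕ} {D : Finset (ℕ × ℕ)}
    (hD : D ∈ connectedOn (inner m j)) : 1 ≤ m := by
  rw [mem_connectedOn] at hD
  obtain ⟨d, hd⟩ := hD.2.2.finset_nonempty
  have := fst_mem_verts hd
  rw [hD.2.1] at this
  obtain ⟨a, ha, -⟩ := Finset.mem_image.1 this
  rw [Finset.mem_Icc] at ha
  omega

theorem IsConnected.union {C D : Finset (ℕ × ℕ)} (hC : IsConnected C) (hD : IsConnected D)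
    {c d : ℕ × ℕ} (hc : c ∈ C) (hd : d ∈ D) (hcd : Meets c d) : IsConnected (C ∪ D) := by
  refine isConnected_iff.2 ⟨⟨c, Finset.mem_union_left D hc⟩, fun T hT hne => ?_⟩
  have key : ∀ E ⊆ C ∪ D, IsConnected E → (T ∩ E).Nonempty → E ⊆ T := by
    intro E hE hEc hne
    have hcl : IsClosedIn E (T ∩ E) := ⟨Finset.inter_subset_right, fun x hx y hy hxy =>
      Finset.mem_inter.2 ⟨hT.2 x (Finset.mem_inter.1 hx).1 y (hE hy) hxy, hy⟩⟩
    exact Finset.inter_eq_right.1 (hEc.eq_of_isClosedIn hcl hne)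
  have keyC := key C Finset.subset_union_left hC
  have keyD := key D Finset.subset_union_right hD
  obtain ⟨t, ht⟩ := hne
  refine hT.1.antisymm ?_
  rcases Finset.mem_union.1 (hT.1 ht) with h | h
  · have hCT := keyC ⟨t, Finset.mem_inter.2 ⟨ht, h⟩⟩
    have hdT := hT.2 c (hCT hc) d (Finset.mem_union_right C hd) hcd
    exact Finset.union_subset hCT (keyD ⟨d, Finset.mem_inter.2 ⟨hdT, hd⟩⟩)
  · have hDT := keyD ⟨t, Finset.mem_inter.2 ⟨ht, h⟩⟩
    have hcT := hT.2 d (hDT hd) c (Finset.mem_union_left D hc) hcd.symm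
    exact Finset.union_subset (keyC ⟨c, Finset.mem_inter.2 ⟨hcT, hc⟩⟩) hDT

/-- Any two connected diagrams can be put together, with the first one becoming the first
component. -/
theorem union_mem_connectedOn {k m j : ℕ} (hj : 1 ≤ j) (hjk : j ≤ 2 * k - 1)
    {K D : Finset (ℕ × ℕ)} (hK : K ∈ connectedOn (outer k m j))
    (hD : D ∈ connectedOn (inner m j)) :
    K ∪ D ∈ connectedOn (Finset.Icc 1 (2 * (k + m))) ∧ Disjoint K D ∧
      ∃ r, r.1 = 1 ∧ IsRoot (K ∪ D) r ∧ IsFirstComponent (K ∪ D) r K := by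
  have hm := one_le_of_mem_connectedOn_inner hD
  rw [mem_connectedOn] at hK hD ⊢
  obtain ⟨hKs, hKv, hKc⟩ := hK
  obtain ⟨hDs, hDv, hDc⟩ := hD
  have hA : ∀ x, x ∈ verts K ↔ _ := fun x => hKv ▸ mem_outer hm (by omega)
  have hB : ∀ x, x ∈ verts D ↔ _ := fun x => hDv ▸ mem_inner hm
  have hdisj : Disjoint (verts K) (verts D) := by
    rw [Finset.disjoint_left]
    intro x hx hx'
    rw [hA] at hx
    rw [hB] at hx'
    omega
  have hs := hKs.union hDs hdisj
  have hKDdisj : Disjoint K D := by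
    rw [Finset.disjoint_left] at hdisj ⊢
    exact fun c hc hd => hdisj (fst_mem_verts hc) (fst_mem_verts hd)
  have hKb : ∀ c ∈ K, c.1 < c.2 ∧
      ((2 ≤ c.1 ∧ c.1 ≤ j + 1) ∨ (j + 2 * m + 1 ≤ c.1 ∧ c.1 ≤ 2 * (k + m))) ∧
      ((2 ≤ c.2 ∧ c.2 ≤ j + 1) ∨ (j + 2 * m + 1 ≤ c.2 ∧ c.2 ≤ 2 * (k + m))) := fun c hc =>
    ⟨hKs.lt c hc, (hA _).1 (fst_mem_verts hc), (hA _).1 (snd_mem_verts hc)⟩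
  have hDb : ∀ d ∈ D, d.1 < d.2 ∧ (d.1 = 1 ∨ (j + 2 ≤ d.1 ∧ d.1 ≤ j + 2 * m)) ∧
      (d.2 = 1 ∨ (j + 2 ≤ d.2 ∧ d.2 ≤ j + 2 * m)) := fun d hd =>
    ⟨hDs.lt d hd, (hB _).1 (fst_mem_verts hd), (hB _).1 (snd_mem_verts hd)⟩
  obtain ⟨r, hr, hr1⟩ : ∃ r ∈ D, r.1 = 1 := by
    obtain ⟨r, hr, h⟩ := mem_verts.1 ((hB 1).2 (Or.inl rfl))
    have := hDb r hr
    exact ⟨r, hr, by omega⟩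
  obtain ⟨e, he, he1⟩ : ∃ e ∈ K, e.1 = 2 := by
    obtain ⟨e, he, h⟩ := mem_verts.1 ((hA 2).2 (by omega))
    have := hKb e he
    exact ⟨e, he, by omega⟩
  have hDr : ∀ d ∈ D, d ≠ r → d.1 ≠ 1 := fun d hd hne h =>
    hne (hDs.eq_of_fst_eq hd hr (h.trans hr1.symm))
  have hrb := hDb r hr
  -- Some chord of `K` leads from the vertices before the gap to those after it: otherwise the
  -- chords before the gap would be closed in `K`.
  obtain ⟨c, hc, hc1, hc2⟩ : ∃ c ∈ K, c.1 ≤ j + 1 ∧ j + 1 < c.2 := by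
    by_contra! hcon
    have hcl : IsClosedIn K (K.filter fun c => c.1 ≤ j + 1) := by
      refine ⟨Finset.filter_subset _ _, fun c hc d hd hcd => ?_⟩
      rw [Finset.mem_filter] at hc ⊢
      have h1 := hKb c hc.1
      have h2 := hKb d hd
      have h3 := hcon c hc.1 hc.2
      refine ⟨hd, ?_⟩
      unfold Meets Crosses at hcd
      omega
    have heq := hKc.eq_of_isClosedIn hcl ⟨e, Finset.mem_filter.2 ⟨he, by omega⟩⟩
    obtain ⟨f, hf, h⟩ := mem_verts.1 ((hA (2 * (k + m))).2 (by omega))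
    have h1 := hKb f hf
    have h2 := (Finset.mem_filter.1 (heq.symm ▸ hf : f ∈ K.filter fun c => c.1 ≤ j + 1)).2
    have h3 := hcon f hf h2
    omega
  have hroot : IsRoot (K ∪ D) r := by
    refine ⟨Finset.mem_union_right K hr, fun c hc => ?_⟩
    rcases Finset.mem_union.1 hc with h | h
    · have := hKb c h
      omega
    · have := hDb c h
      omega
  have hrK : r ∉ K := fun h => by
    have := hKb r h
    omega
  refine ⟨⟨hs, ?_, hKc.union hDc hc hr ?_⟩, hKDdisj, r, hr1, hroot, ?_, hKc, e, he, ?_⟩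
  · rw [verts_union]
    ext x
    rw [Finset.mem_union, hA, hB, Finset.mem_Icc]
    omega
  · have := hKb c hc
    unfold Meets Crosses
    omega
  · refine ⟨fun c hc => Finset.mem_erase.2
      ⟨fun h => hrK (h ▸ hc), Finset.mem_union_left D hc⟩, fun c hc d hd hcd => ?_⟩
    rw [Finset.mem_erase, Finset.mem_union] at hd
    refine hd.2.resolve_right fun hdD => ?_
    have h1 := hKb c hc
    have h2 := hDb d hdD
    have h3 := hDr d hdD hd.1
    unfold Meets Crosses at hcd
    omega
  · refine ⟨Finset.mem_erase.2 ⟨fun h => hrK (h ▸ he), Finset.mem_union_left D he⟩,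
      fun c hc => ?_⟩
    rw [Finset.mem_erase, Finset.mem_union] at hc
    rcases hc.2 with h | h
    · have := hKb c h
      omega
    · have h1 := hDb c h
      have h2 := hDr c h hc.1
      omega

/-- Removal of the first component leaves a connected set of chords: every other component is
attached to the root chord. -/
theorem IsFirstComponent.isConnected_sdiff {C K : Finset (ℕ × ℕ)} {r : ℕ × ℕ}
    (hconn : IsConnected C) (hr : IsRoot C r) (hK : IsFirstComponent C r K) :
    IsConnected (C \ K) := by
  have hrD : r ∈ C \ K := Finset.mem_sdiff.2 ⟨hr.1, hK.notMem⟩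
  refine isConnected_iff.2 ⟨⟨r, hrD⟩, fun T hT hne => hT.1.antisymm ?_⟩
  by_cases hrT : r ∈ T
  · by_contra hsub
    rw [← Finset.sdiff_nonempty] at hsub
    have hcl : IsClosedIn C ((C \ K) \ T) := by
      refine ⟨Finset.sdiff_subset.trans Finset.sdiff_subset, fun c hc d hd hcd => ?_⟩
      rw [Finset.mem_sdiff, Finset.mem_sdiff] at hc ⊢
      have hcr : c ≠ r := fun h => hc.2 (h ▸ hrT)
      refine ⟨⟨hd, fun hdK => hc.1.2 ?_⟩, fun hdT => hc.2 ?_⟩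
      · exact hK.closed.2 d hdK c (Finset.mem_erase.2 ⟨hcr, hc.1.1⟩) hcd.symm
      · exact hT.2 d hdT c (Finset.mem_sdiff.2 hc.1) hcd.symm
    have := hconn.eq_of_isClosedIn hcl hsub
    exact (Finset.mem_sdiff.1 (this.symm ▸ hr.1 : r ∈ (C \ K) \ T)).2 hrT
  · have hcl : IsClosedIn C T := by
      refine ⟨hT.1.trans Finset.sdiff_subset, fun c hc d hd hcd => ?_⟩
      have hcC := Finset.mem_sdiff.1 (hT.1 hc)
      refine hT.2 c hc d (Finset.mem_sdiff.2 ⟨hd, fun hdK => hcC.2 ?_⟩) hcd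
      exact hK.closed.2 d hdK c
        (Finset.mem_erase.2 ⟨fun h => hrT (h ▸ hc), hcC.1⟩) hcd.symm
    exact absurd (hconn.eq_of_isClosedIn hcl hne ▸ hr.1 : r ∈ T) hrT

/-- No vertex of the first component lies under a chord outside it, the root chord excepted. -/
theorem IsFirstComponent.not_between {C K : Finset (ℕ × ℕ)} {r : ℕ × ℕ} (hC : IsChordSet C)
    (hK : IsFirstComponent C r K) {d : ℕ × ℕ} (hd : d ∈ C) (hdr : d ≠ r)
    (hdK : d ∉ K) {x : ℕ} (hx : x ∈ verts K) : ¬ (d.1 < x ∧ x < d.2) := by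
  intro hdx
  have hno : ∀ c ∈ K, c.1 < c.2 ∧ ¬ Meets c d ∧ c.1 ≠ d.1 ∧ c.2 ≠ d.2 ∧ c.1 ≠ d.2 ∧ c.2 ≠ d.1 := by
    intro c hc
    have hcC := hK.subset hc
    have hne : ∀ y, (y = c.1 ∨ y = c.2) → (y = d.1 ∨ y = d.2) → False := fun y h1 h2 =>
      hdK (hC.eq_of_mem c hcC d hd y h1 h2 ▸ hc)
    refine ⟨hC.lt c hcC, fun h => hdK (hK.closed.2 c hc d (Finset.mem_erase.2 ⟨hdr, hd⟩) h),
      fun h => hne _ (Or.inl rfl) (Or.inl h), fun h => hne _ (Or.inr rfl) (Or.inr h),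
      fun h => hne _ (Or.inl rfl) (Or.inr h), fun h => hne _ (Or.inr rfl) (Or.inl h)⟩
  -- The chords of `K` under `d` are closed in `K`, so they are all of `K`; but the first vertex
  -- of `K` precedes `d`.
  have hcl : IsClosedIn K (K.filter fun c => d.1 < c.1 ∧ c.2 < d.2) := by
    refine ⟨Finset.filter_subset _ _, fun c hc e he hce => ?_⟩
    rw [Finset.mem_filter] at hc ⊢
    have h1 := hno c hc.1
    have h2 := hno e he
    refine ⟨he, ?_⟩
    unfold Meets Crosses at *
    omega
  obtain ⟨c, hc, hxc⟩ := mem_verts.1 hx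
  have hcf : c ∈ K.filter fun c => d.1 < c.1 ∧ c.2 < d.2 := by
    have h1 := hno c hc
    refine Finset.mem_filter.2 ⟨hc, ?_⟩
    unfold Meets Crosses at *
    omega
  obtain ⟨e, heK, he⟩ := hK.exists_isRoot
  have heq := hK.connected.eq_of_isClosedIn hcl ⟨c, hcf⟩
  have h1 := (Finset.mem_filter.1
    (heq.symm ▸ heK : e ∈ K.filter fun c => d.1 < c.1 ∧ c.2 < d.2)).2
  have h2 := he.2 d (Finset.mem_erase.2 ⟨hdr, hd⟩)
  omega

/-- Every connected diagram with at least two chords arises from two connected diagrams by insertion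
of one of them, without its first vertex, into a gap of the other. -/
theorem exists_union_eq {n : ℕ} (hn : 2 ≤ n) {C : Finset (ℕ × ℕ)}
    (hC : C ∈ connectedOn (Finset.Icc 1 (2 * n))) :
    ∃ k m j K D, k + m = n ∧ 1 ≤ j ∧ j ≤ 2 * k - 1 ∧ K ∈ connectedOn (outer k m j) ∧
      D ∈ connectedOn (inner m j) ∧ K ∪ D = C := by
  obtain ⟨hs, hv, hconn⟩ := mem_connectedOn.1 hC
  have hmem : ∀ x, x ∈ verts C ↔ 1 ≤ x ∧ x ≤ 2 * n := fun x => by rw [hv, Finset.mem_Icc]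
  have hCb : ∀ c ∈ C, c.1 < c.2 ∧ 1 ≤ c.1 ∧ c.2 ≤ 2 * n := fun c hc =>
    ⟨hs.lt c hc, ((hmem _).1 (fst_mem_verts hc)).1, ((hmem _).1 (snd_mem_verts hc)).2⟩
  have hcard : C.card = n := by
    have := hs.card_verts
    rw [hv, Nat.card_Icc] at this
    omega
  obtain ⟨r, hr⟩ : ∃ r, IsRoot C r := ⟨_, isRoot_root C hconn.finset_nonempty⟩
  have hr1 : r.1 = 1 := by
    obtain ⟨c, hc, h⟩ := mem_verts.1 ((hmem 1).2 (by omega))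
    have h1 := hCb c hc
    have h2 := hr.2 c hc
    have h3 := hCb r hr.1
    omega
  have hCr : ∀ c ∈ C, c ≠ r → 1 < c.1 := fun c hc hne => by
    have h1 := hCb c hc
    have h2 : c.1 ≠ 1 := fun h => hne (hs.eq_of_fst_eq hc hr.1 (h.trans hr1.symm))
    omega
  have hne : (C.erase r).Nonempty := by
    rw [← Finset.card_pos, Finset.card_erase_of_mem hr.1]
    omega
  obtain ⟨K, hK⟩ := exists_isFirstComponent hne
  have hKC := hK.subset
  have hrK := hK.notMem
  obtain ⟨e, heK, he⟩ := hK.exists_isRoot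
  have he1 : e.1 = 2 := by
    obtain ⟨d, hd, hrd⟩ := hconn.exists_crosses_root hr hne
    obtain ⟨c, hc, h⟩ := mem_verts.1 ((hmem 2).2 (by omega))
    have hdb := hCr d (Finset.mem_of_mem_erase hd) (Finset.ne_of_mem_erase hd)
    have hcr : c ≠ r := by
      rintro rfl
      unfold Crosses at hrd
      omega
    have h1 := hCb c hc
    have h2 := he.2 c (Finset.mem_erase.2 ⟨hcr, hc⟩)
    have h3 := hCr e (hKC heK) (fun h => hrK (h ▸ heK))
    omega
  obtain ⟨c, hcK, hcr⟩ : ∃ c ∈ K, Meets c r := by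
    by_contra! hcon
    have hcl : IsClosedIn C K := by
      refine ⟨hKC, fun c hc d hd hcd => hK.closed.2 c hc d (Finset.mem_erase.2 ⟨?_, hd⟩) hcd⟩
      rintro rfl
      exact hcon c hc hcd
    have heq := hconn.eq_of_isClosedIn hcl hK.connected.finset_nonempty
    exact hrK (heq.symm ▸ hr.1)
  have hcb := hCb c (hKC hcK)
  unfold Meets Crosses at hcr
  -- `p` and `q` are the vertices of `K` next to the end of the root chord.
  obtain ⟨p, hp, hpmax⟩ := ((verts K).filter (· < r.2)).exists_max_image id
    ⟨c.1, Finset.mem_filter.2 ⟨fst_mem_verts hcK, by omega⟩⟩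
  obtain ⟨q, hq, hqmin⟩ := ((verts K).filter (r.2 < ·)).exists_min_image id
    ⟨c.2, Finset.mem_filter.2 ⟨snd_mem_verts hcK, by omega⟩⟩
  simp only [Finset.mem_filter, id, and_imp] at hp hq hpmax hqmin
  have hp2 := hpmax 2 (he1 ▸ fst_mem_verts heK) (by
    have := hCr c (hKC hcK) (fun h => hrK (h ▸ hcK))
    omega)
  have hKb : ∀ x ∈ verts K, 2 ≤ x ∧ x ≤ 2 * n := by
    intro x hx
    obtain ⟨d, hd, h⟩ := mem_verts.1 hx
    have h1 := hCb d (hKC hd)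
    have h2 := hCr d (hKC hd) (fun h => hrK (h ▸ hd))
    omega
  have hq2 := hKb q hq.1
  have hdisj : ∀ x ∈ verts K, ∀ d ∈ C \ K, x ≠ d.1 ∧ x ≠ d.2 := by
    intro x hx d hd
    obtain ⟨f, hf, hxf⟩ := mem_verts.1 hx
    rw [Finset.mem_sdiff] at hd
    exact ⟨fun h => hd.2 (hs.eq_of_mem f (hKC hf) d hd.1 x hxf (Or.inl h) ▸ hf),
      fun h => hd.2 (hs.eq_of_mem f (hKC hf) d hd.1 x hxf (Or.inr h) ▸ hf)⟩
  -- The chords outside `K` that do not lie between `p` and `q` form a closed set without the root.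
  have hDb : ∀ d ∈ C \ K, d ≠ r → p < d.1 ∧ d.2 < q := by
    intro d hd hdr
    by_contra hdpq
    have hL : ∀ d ∈ C \ K, d ≠ r → ¬ (p < d.1 ∧ d.2 < q) → 1 < d.1 ∧ d.1 < d.2 ∧
        (d.2 < p ∨ q < d.1) := by
      intro d hd hdr hdpq
      have hd' := Finset.mem_sdiff.1 hd
      have h1 := hK.not_between hs hd'.1 hdr hd'.2 hp.1
      have h2 := hK.not_between hs hd'.1 hdr hd'.2 hq.1
      have h3 := hdisj p hp.1 d hd
      have h4 := hdisj q hq.1 d hd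
      have h5 := hCb d hd'.1
      have h6 := hCr d hd'.1 hdr
      omega
    have hcl : IsClosedIn C ((C \ K).filter fun d => d ≠ r ∧ ¬ (p < d.1 ∧ d.2 < q)) := by
      refine ⟨(Finset.filter_subset _ _).trans Finset.sdiff_subset, fun a ha b hb hab => ?_⟩
      rw [Finset.mem_filter] at ha ⊢
      have ha' := Finset.mem_sdiff.1 ha.1
      have h1 := hL a ha.1 ha.2.1 ha.2.2
      have hbr : b ≠ r := by
        rintro rfl
        unfold Meets Crosses at hab
        omega
      have hbD : b ∈ C \ K := Finset.mem_sdiff.2 ⟨hb, fun hbK => ha'.2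
        (hK.closed.2 b hbK a (Finset.mem_erase.2 ⟨ha.2.1, ha'.1⟩) hab.symm)⟩
      refine ⟨hbD, hbr, fun h => ?_⟩
      have h2 := hCb b hb
      unfold Meets Crosses at hab
      omega
    have heq := hconn.eq_of_isClosedIn hcl ⟨d, Finset.mem_filter.2 ⟨hd, hdr, hdpq⟩⟩
    exact (Finset.mem_filter.1 (heq.symm ▸ hr.1 :
      r ∈ (C \ K).filter fun d => d ≠ r ∧ ¬ (p < d.1 ∧ d.2 < q))).2.1 rfl
  have hrD : r ∈ C \ K := Finset.mem_sdiff.2 ⟨hr.1, hrK⟩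
  have hKpq : ∀ x ∈ verts K, x ≤ p ∨ q ≤ x := by
    intro x hx
    have h1 := hdisj x hx r hrD
    have h2 := hpmax x hx
    have h3 := hqmin x hx
    omega
  have hunion : K ∪ C \ K = C := Finset.union_sdiff_of_subset hKC
  have hDpq : ∀ x ∈ verts (C \ K), x = 1 ∨ (p < x ∧ x < q) := by
    intro x hx
    obtain ⟨d, hd, h⟩ := mem_verts.1 hx
    by_cases hdr : d = r
    · subst hdr
      omega
    · have h1 := hDb d hd hdr
      have h2 := hCb d (Finset.mem_sdiff.1 hd).1
      omega
  have hor : ∀ x, x ∈ verts K ∨ x ∈ verts (C \ K) ↔ 1 ≤ x ∧ x ≤ 2 * n := fun x => by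
    rw [← hmem, ← Finset.mem_union, ← verts_union, hunion]
  have hvK : ∀ x, x ∈ verts K ↔ (2 ≤ x ∧ x ≤ p) ∨ (q ≤ x ∧ x ≤ 2 * n) := by
    intro x
    constructor
    · intro hx
      have h1 := hKb x hx
      have h2 := hKpq x hx
      omega
    · intro hx
      refine ((hor x).2 (by omega)).resolve_right fun h => ?_
      have := hDpq x h
      omega
  have hvD : ∀ x, x ∈ verts (C \ K) ↔ x = 1 ∨ (p + 1 ≤ x ∧ x ≤ q - 1) := by
    intro x
    constructor
    · intro hx
      have := hDpq x hx
      omega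
    · intro hx
      refine ((hor x).2 (by omega)).resolve_left fun h => ?_
      have := (hvK x).1 h
      omega
  have hcardD : q = p + 2 * (C \ K).card := by
    have h1 : verts (C \ K) = insert 1 (Finset.Icc (p + 1) (q - 1)) := by
      ext x
      rw [hvD, Finset.mem_insert, Finset.mem_Icc]
    have h2 := (hs.mono (Finset.sdiff_subset (s := C) (t := K))).card_verts
    rw [h1, Finset.card_insert_of_notMem (by rw [Finset.mem_Icc]; omega), Nat.card_Icc] at h2
    omega
  have hcardK : K.card + (C \ K).card = n := by
    rw [← hcard, add_comm, Finset.card_sdiff_add_card_eq_card hKC]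
  refine ⟨K.card, (C \ K).card, p - 1, K, C \ K, hcardK, by omega, by omega, ?_, ?_, hunion⟩
  · refine mem_connectedOn.2 ⟨hs.mono hKC, ?_, hK.connected⟩
    ext x
    rw [hvK, mem_outer (by omega) (by omega)]
    omega
  · refine mem_connectedOn.2 ⟨hs.mono Finset.sdiff_subset, ?_, hK.isConnected_sdiff hconn hr⟩
    ext x
    rw [hvD, mem_inner (by omega)]
    omega

open Classical in
/-- Summation over connected diagrams by means of their first component `K` and its complement
`D`. The terms with `p.1 = 0` or `p.2 = 0` are empty sums: there is no gap in the first case, no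
connected `D` in the second. -/
theorem sum_connectedOn_Icc {n : ℕ} (hn : 2 ≤ n) (g : Finset (ℕ × ℕ) → ℕ) :
    ∑ C ∈ connectedOn (Finset.Icc 1 (2 * n)), g C =
      ∑ p ∈ antidiagonal n, ∑ j ∈ Finset.Icc 1 (2 * p.1 - 1),
        ∑ K ∈ connectedOn (outer p.1 p.2 j), ∑ D ∈ connectedOn (inner p.2 j), g (K ∪ D) := by
  simp only [Finset.sum_sigma']
  symm
  refine Finset.sum_nbij (fun x => x.2.2.1 ∪ x.2.2.2) ?_ ?_ ?_ fun _ _ => rfl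
  · rintro ⟨⟨k, m⟩, j, K, D⟩ hx
    simp only [Finset.mem_sigma, mem_antidiagonal, Finset.mem_Icc] at hx
    obtain ⟨rfl, hj, hK, hD⟩ := hx
    exact (union_mem_connectedOn hj.1 hj.2 hK hD).1
  · rintro ⟨⟨k, m⟩, j, K, D⟩ hx ⟨⟨k', m'⟩, j', K', D'⟩ hx' h
    simp only [Finset.coe_sigma, Set.mem_sigma_iff, Finset.mem_coe, mem_antidiagonal,
      Finset.mem_Icc] at hx hx' h
    obtain ⟨hkm, hj, hK, hD⟩ := hx
    obtain ⟨hkm', hj', hK', hD'⟩ := hx'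
    have hm := one_le_of_mem_connectedOn_inner hD
    have hm' := one_le_of_mem_connectedOn_inner hD'
    obtain ⟨hC, hdisj, r, hr1, hr, hF⟩ := union_mem_connectedOn hj.1 hj.2 hK hD
    obtain ⟨-, hdisj', r', hr1', hr', hF'⟩ := union_mem_connectedOn hj'.1 hj'.2 hK' hD'
    have hCs := (mem_connectedOn.1 hC).1
    rw [← h] at hr' hF'
    obtain rfl : r = r' := hCs.eq_of_fst_eq hr.1 hr'.1 (hr1.trans hr1'.symm)
    obtain rfl : K = K' := hF.unique hCs hF'
    obtain rfl : D = D' := by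
      rw [← Finset.union_sdiff_cancel_left hdisj, h, Finset.union_sdiff_cancel_left hdisj']
    rw [mem_connectedOn] at hK hK' hD hD'
    obtain rfl : m = m' := by
      have h1 := congrArg Finset.card (hD.2.1.symm.trans hD'.2.1)
      rw [inner, inner, Finset.card_image_of_injective _ (strictMono_innerLabel j).injective,
        Finset.card_image_of_injective _ (strictMono_innerLabel j').injective, Nat.card_Icc,
        Nat.card_Icc] at h1
      omega
    obtain rfl : k = k' := by omega
    -- The first vertex after the gap of length `j` tells `j` apart from larger values.
    have hle : ∀ a b, inner m a = inner m b → b ≤ a := by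
      intro a b hab
      have h1 : a + 2 ∈ inner m b := hab ▸ (mem_inner hm).2 (by omega)
      have h2 := (mem_inner hm).1 h1
      omega
    have hDv := hD.2.1.symm.trans hD'.2.1
    obtain rfl : j = j' := le_antisymm (hle _ _ hDv.symm) (hle _ _ hDv)
    rfl
  · intro C hC
    obtain ⟨k, m, j, K, D, hkm, hj, hjk, hK, hD, rfl⟩ := exists_union_eq hn hC
    exact ⟨⟨(k, m), j, K, D⟩, by simpa using ⟨hkm, ⟨hj, hjk⟩, hK, hD⟩, rfl⟩

/-! ### Recurrences for the number of diagrams and for the total index -/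

theorem connectedChordDiagrams_zero : connectedChordDiagrams 0 = ∅ := by
  rw [connectedChordDiagrams_eq, Finset.eq_empty_iff_forall_notMem]
  intro C hC
  rw [mem_connectedOn] at hC
  obtain ⟨c, hc⟩ := hC.2.2.finset_nonempty
  have := fst_mem_verts hc
  rw [hC.2.1] at this
  simp at this

theorem connectedChordDiagrams_one : connectedChordDiagrams 1 = {{(1, 2)}} := by
  rw [connectedChordDiagrams_eq]
  ext C
  rw [mem_connectedOn, Finset.mem_singleton]
  constructor
  · rintro ⟨hs, hv, hconn⟩
    refine Finset.eq_singleton_iff_nonempty_unique_mem.2 ⟨hconn.finset_nonempty, fun c hc => ?_⟩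
    have h1 := fst_mem_verts hc
    have h2 := snd_mem_verts hc
    have h3 := hs.lt c hc
    rw [hv, Finset.mem_Icc] at h1 h2
    exact Prod.ext (by simp; omega) (by simp; omega)
  · rintro rfl
    refine ⟨⟨by simp, by simp⟩, by simp [verts]; rfl, isConnected_iff.2 ⟨by simp, ?_⟩⟩
    intro T hT hne
    exact (Finset.subset_singleton_iff.1 hT.1).resolve_left hne.ne_empty

theorem card_connectedChordDiagrams {n : ℕ} (hn : 2 ≤ n) :
    (connectedChordDiagrams n).card = ∑ p ∈ antidiagonal n,
      (2 * p.1 - 1) * ((connectedChordDiagrams p.1).card * (connectedChordDiagrams p.2).card) := by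
  classical
  have h := sum_connectedOn_Icc hn fun _ => 1
  simp only [Finset.sum_const, smul_eq_mul, mul_one] at h
  simp only [connectedChordDiagrams_eq, h]
  refine Finset.sum_congr rfl fun p _ => ?_
  simp only [outer, inner, card_connectedOn_image (strictMono_outerLabel _ _),
    card_connectedOn_image (strictMono_innerLabel _), Finset.sum_const, Nat.card_Icc, smul_eq_mul]
  rfl

/-- The sum of the index of the first terminal chord over all connected diagrams with `n`
chords. -/
noncomputable def totalIndex (n : ℕ) : ℕ :=
  ∑ C ∈ connectedChordDiagrams n, firstTerminalIndex C

theorem totalIndex_eq {n : ℕ} (hn : 2 ≤ n) :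
    totalIndex n = ∑ p ∈ antidiagonal n,
      (2 * p.1 - 1) * ((totalIndex p.1 + (connectedChordDiagrams p.1).card) *
        (connectedChordDiagrams p.2).card) := by
  classical
  simp only [totalIndex, connectedChordDiagrams_eq, sum_connectedOn_Icc hn]
  refine Finset.sum_congr rfl fun p _ => ?_
  have hj : ∀ j ∈ Finset.Icc 1 (2 * p.1 - 1), ∑ K ∈ connectedOn (outer p.1 p.2 j),
      ∑ D ∈ connectedOn (inner p.2 j), firstTerminalIndex (K ∪ D) =
      (∑ K ∈ connectedOn (Finset.Icc 1 (2 * p.1)), firstTerminalIndex K +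
        (connectedOn (Finset.Icc 1 (2 * p.1))).card) *
      (connectedOn (Finset.Icc 1 (2 * p.2))).card := by
    intro j hj
    rw [Finset.mem_Icc] at hj
    have hKD : ∀ K ∈ connectedOn (outer p.1 p.2 j), ∀ D ∈ connectedOn (inner p.2 j),
        firstTerminalIndex (K ∪ D) = firstTerminalIndex K + 1 := by
      intro K hK D hD
      obtain ⟨hC, -, r, -, hr, hF⟩ := union_mem_connectedOn hj.1 hj.2 hK hD
      rw [mem_connectedOn] at hC
      exact firstTerminalIndex_eq_add_one hC.1 hC.2.2 hr hF
    rw [Finset.sum_congr rfl fun K hK => Finset.sum_congr rfl (hKD K hK)]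
    simp only [Finset.sum_const, smul_eq_mul]
    rw [← Finset.mul_sum, Finset.sum_add_distrib, mul_comm]
    simp only [outer, inner, card_connectedOn_image (strictMono_outerLabel _ _),
      card_connectedOn_image (strictMono_innerLabel _),
      sum_firstTerminalIndex_connectedOn_image (strictMono_outerLabel _ _), Finset.sum_const,
      smul_eq_mul, mul_one]
  rw [Finset.sum_congr rfl hj, Finset.sum_const, Nat.card_Icc, smul_eq_mul]
  rfl

/-! ### Growth of the number of connected diagrams -/

theorem sum_antidiagonal_add_two (f : ℕ × ℕ → ℝ) (n : ℕ) :
    ∑ p ∈ antidiagonal (n + 2), f p =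
      f (0, n + 2) + f (n + 2, 0) + ∑ p ∈ antidiagonal n, f (p.1 + 1, p.2 + 1) := by
  rw [Finset.Nat.sum_antidiagonal_succ, Finset.Nat.sum_antidiagonal_succ']
  exact (add_assoc _ _ _).symm

/-- The recurrence for the number of connected chord diagrams, as a property of a real sequence.
The negative weight at `p.1 = 0` is harmless because `c 0 = 0`. -/
structure IsConnectedCount (c : ℕ → ℝ) : Prop where
  zero : c 0 = 0
  one : c 1 = 1
  rec_eq : ∀ n, 2 ≤ n →
    c n = ∑ p ∈ antidiagonal n, (2 * (p.1 : ℝ) - 1) * (c p.1 * c p.2)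

namespace IsConnectedCount

variable {c : ℕ → ℝ}

/-- Symmetrization of the recurrence. -/
theorem eq_mul_sum (hc : IsConnectedCount c) {n : ℕ} (hn : 2 ≤ n) :
    c n = (n - 1) * ∑ p ∈ antidiagonal n, c p.1 * c p.2 := by
  have h1 := hc.rec_eq n hn
  have h2 := h1
  rw [← Finset.Nat.sum_antidiagonal_swap] at h2
  have h3 : c n + c n = 2 * ((n - 1) * ∑ p ∈ antidiagonal n, c p.1 * c p.2) := by
    nth_rewrite 1 [h1]
    rw [h2, ← Finset.sum_add_distrib, Finset.mul_sum, Finset.mul_sum]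
    refine Finset.sum_congr rfl fun p hp => ?_
    rw [mem_antidiagonal] at hp
    rw [← hp]
    simp only [Prod.fst_swap, Prod.snd_swap]
    push_cast
    ring
  linarith

theorem sum_antidiagonal_eq (hc : IsConnectedCount c) (n : ℕ) :
    ∑ p ∈ antidiagonal (n + 4), c p.1 * c p.2 =
      2 * c (n + 3) + ∑ p ∈ antidiagonal n, c (p.1 + 2) * c (p.2 + 2) := by
  rw [sum_antidiagonal_add_two, sum_antidiagonal_add_two]
  simp only [hc.zero, hc.one, zero_add]
  ring

theorem two (hc : IsConnectedCount c) : c 2 = 1 := by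
  rw [hc.eq_mul_sum le_rfl, Finset.Nat.sum_antidiagonal_succ, Finset.Nat.sum_antidiagonal_succ]
  simp [hc.zero, hc.one]
  norm_num

theorem three (hc : IsConnectedCount c) : c 3 = 4 := by
  rw [hc.eq_mul_sum (by norm_num), Finset.Nat.sum_antidiagonal_succ,
    Finset.Nat.sum_antidiagonal_succ, Finset.Nat.sum_antidiagonal_succ]
  simp [hc.zero, hc.one, hc.two]
  norm_num

theorem four (hc : IsConnectedCount c) : c 4 = 27 := by
  rw [hc.eq_mul_sum (by norm_num), hc.sum_antidiagonal_eq 0]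
  simp [hc.two, hc.three]
  norm_num

theorem five (hc : IsConnectedCount c) : c 5 = 248 := by
  rw [hc.eq_mul_sum (by norm_num), hc.sum_antidiagonal_eq 1, Finset.Nat.sum_antidiagonal_succ]
  simp [hc.two, hc.three, hc.four]
  norm_num

theorem nonneg (hc : IsConnectedCount c) (n : ℕ) : 0 ≤ c n := by
  induction n using Nat.strong_induction_on with
  | _ n ih =>
    rcases Nat.lt_or_ge n 2 with h | h
    · interval_cases n
      · exact hc.zero.ge
      · rw [hc.one]; exact zero_le_one
    · rw [hc.eq_mul_sum h]
      have hn : (2 : ℝ) ≤ n := by exact_mod_cast h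
      refine mul_nonneg (by linarith) (Finset.sum_nonneg fun p hp => ?_)
      rw [mem_antidiagonal] at hp
      rcases Nat.eq_zero_or_pos p.1 with h1 | h1
      · simp [h1, hc.zero]
      rcases Nat.eq_zero_or_pos p.2 with h2 | h2
      · simp [h2, hc.zero]
      exact mul_nonneg (ih _ (by omega)) (ih _ (by omega))

theorem two_mul_le (hc : IsConnectedCount c) {n : ℕ} (hn : 2 ≤ n) :
    2 * (n : ℝ) * c n ≤ c (n + 1) := by
  rcases Nat.lt_or_ge n 3 with h | h
  · obtain rfl : n = 2 := by omega
    rw [hc.two, hc.three]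
    norm_num
  · obtain ⟨n, rfl⟩ := Nat.exists_eq_add_of_le' h
    rw [hc.eq_mul_sum (n := n + 3 + 1) (by omega), hc.sum_antidiagonal_eq]
    have h0 : 0 ≤ ∑ p ∈ antidiagonal n, c (p.1 + 2) * c (p.2 + 2) :=
      Finset.sum_nonneg fun p _ => mul_nonneg (hc.nonneg _) (hc.nonneg _)
    have h1 := mul_nonneg (Nat.cast_nonneg (α := ℝ) (n + 3)) h0
    push_cast at h1 ⊢
    linarith

theorem pos (hc : IsConnectedCount c) {n : ℕ} (hn : 1 ≤ n) : 0 < c n := by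
  induction n, hn using Nat.le_induction with
  | base => rw [hc.one]; exact one_pos
  | succ n hn ih =>
    rcases Nat.lt_or_ge n 2 with h | h
    · obtain rfl : n = 1 := by omega
      rw [hc.two]
      exact one_pos
    · have h0 : (0 : ℝ) < n := by exact_mod_cast hn
      exact lt_of_lt_of_le (by positivity) (hc.two_mul_le h)

/-- If the upper bound on consecutive quotients holds up to index `b`, then products of two values
with constant index sum grow as the indices move apart. -/
theorem mul_le_mul_of_upper (hc : IsConnectedCount c) {t d b : ℕ} (ht : 1 ≤ t) (hb : t + d ≤ b)
    (hb2 : 2 ≤ b) (hup : ∀ a, 1 ≤ a → a + 1 ≤ t + d → c (a + 1) ≤ 2 * ((a : ℝ) + 1) * c a) :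
    c (t + d) * c b ≤ c t * c (b + d) := by
  induction d generalizing b with
  | zero => simp
  | succ d ih =>
    have h1 := ih (b := b + 1) (by omega) (by omega) fun a ha hab => hup a ha (by omega)
    have h2 := hup (t + d) (by omega) (by omega)
    have h3 := hc.two_mul_le hb2
    have h4 : ((t + d : ℕ) : ℝ) + 1 ≤ b := by exact_mod_cast hb
    have h5 : c (t + d + 1) * c b ≤ c (t + d) * c (b + 1) := by
      calc c (t + d + 1) * c b
          ≤ 2 * (((t + d : ℕ) : ℝ) + 1) * c (t + d) * c b :=
            mul_le_mul_of_nonneg_right h2 (hc.nonneg b)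
        _ = (((t + d : ℕ) : ℝ) + 1) * (2 * (c (t + d) * c b)) := by ring
        _ ≤ b * (2 * (c (t + d) * c b)) := by
            refine mul_le_mul_of_nonneg_right h4 ?_
            have := mul_nonneg (hc.nonneg (t + d)) (hc.nonneg b)
            positivity
        _ = c (t + d) * (2 * b * c b) := by ring
        _ ≤ c (t + d) * c (b + 1) := mul_le_mul_of_nonneg_left h3 (hc.nonneg _)
    calc c (t + (d + 1)) * c b ≤ c (t + d) * c (b + 1) := h5
      _ ≤ c t * c (b + 1 + d) := h1
      _ = c t * c (b + (d + 1)) := by rw [add_assoc b, add_comm 1 d]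

theorem sum_mul_le_of_upper (hc : IsConnectedCount c) {t m : ℕ} (ht : 2 ≤ t)
    (hup : ∀ a, 1 ≤ a → a + 1 ≤ m + t → c (a + 1) ≤ 2 * ((a : ℝ) + 1) * c a) :
    ∑ p ∈ antidiagonal m, c (p.1 + t) * c (p.2 + t) ≤ (m + 1) * (c t * c (m + t)) := by
  have key : ∀ p ∈ antidiagonal m, c (p.1 + t) * c (p.2 + t) ≤ c t * c (m + t) := by
    intro p hp
    rw [mem_antidiagonal] at hp
    rcases le_total p.1 p.2 with h | h
    · have := hc.mul_le_mul_of_upper (t := t) (d := p.1) (b := p.2 + t) (by omega) (by omega)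
        (by omega) fun a ha hab => hup a ha (by omega)
      rwa [add_comm t, show p.2 + t + p.1 = m + t by omega] at this
    · have := hc.mul_le_mul_of_upper (t := t) (d := p.2) (b := p.1 + t) (by omega) (by omega)
        (by omega) fun a ha hab => hup a ha (by omega)
      rwa [add_comm t, show p.1 + t + p.2 = m + t by omega, mul_comm] at this
  have := Finset.sum_le_card_nsmul _ _ _ key
  rwa [Finset.Nat.card_antidiagonal, nsmul_eq_mul, Nat.cast_succ] at this

/-- The upper bound matching `two_mul_le`. In the recurrence all terms but the four outermost ones
are bounded by `c 3 * c (n - 2)`, by the induction hypothesis. -/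
theorem le_two_mul (hc : IsConnectedCount c) {n : ℕ} (hn : 1 ≤ n) :
    c (n + 1) ≤ 2 * ((n : ℝ) + 1) * c n := by
  induction n using Nat.strong_induction_on with
  | _ n ih =>
    rcases Nat.lt_or_ge n 5 with h | h
    · interval_cases n <;> norm_num [hc.one, hc.two, hc.three, hc.four, hc.five]
    · obtain ⟨m, rfl⟩ := Nat.exists_eq_add_of_le' h
      have hsum : ∑ p ∈ antidiagonal (m + 2), c (p.1 + 2) * c (p.2 + 2) =
          2 * c (m + 4) + ∑ p ∈ antidiagonal m, c (p.1 + 3) * c (p.2 + 3) := by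
        rw [sum_antidiagonal_add_two]
        simp only [zero_add, hc.two]
        ring
      rw [hc.eq_mul_sum (n := m + 5 + 1) (by omega), hc.sum_antidiagonal_eq (m + 2), hsum]
      have h1 := hc.sum_mul_le_of_upper (t := 3) (m := m) (by norm_num)
        fun a ha hab => ih a (by omega) ha
      have h2 := hc.two_mul_le (n := m + 3) (by omega)
      have h3 := hc.two_mul_le (n := m + 4) (by omega)
      have h4 := hc.nonneg (m + 4)
      have hm : (0 : ℝ) ≤ m := Nat.cast_nonneg m
      rw [hc.three] at h1
      push_cast at h2 h3 ⊢
      rw [show m + 2 + 3 = m + 5 from rfl, show m + 3 + 1 = m + 4 from rfl] at *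
      rw [show m + 4 + 1 = m + 5 from rfl] at h3
      -- The bound on the sum by a multiple of `c (m + 4)`, cleared of the denominator `m + 3`.
      have h5 : (m + 3 : ℝ) * ∑ p ∈ antidiagonal m, c (p.1 + 3) * c (p.2 + 3) ≤
          2 * (m + 1) * c (m + 4) := by
        have h6 := mul_le_mul_of_nonneg_left h1 (by linarith : (0 : ℝ) ≤ m + 3)
        have h7 := mul_le_mul_of_nonneg_left h2 (by linarith : (0 : ℝ) ≤ 2 * (m + 1))
        linarith
      set s := ∑ p ∈ antidiagonal m, c (p.1 + 3) * c (p.2 + 3)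
      have h8 : (m + 5 : ℝ) * (2 * c (m + 4) + s) ≤ 2 * c (m + 5) := by
        have h9 : (m + 3 : ℝ) * ((m + 5) * (2 * c (m + 4) + s)) ≤
            (m + 3) * (2 * c (m + 5)) := by
          have h10 := mul_le_mul_of_nonneg_left h5 (by linarith : (0 : ℝ) ≤ m + 5)
          have h11 := mul_le_mul_of_nonneg_left h3 (by linarith : (0 : ℝ) ≤ 2 * (m + 3))
          linarith
        exact le_of_mul_le_mul_left h9 (by linarith)
      linarith

/-! ### The average size of the part outside the first component -/

theorem sum_drift_bounds (hc : IsConnectedCount c) (m : ℕ) :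
    (3 * (m : ℝ) + 14) * c (m + 5) ≤
        ∑ p ∈ antidiagonal (m + 6), (2 * (p.1 : ℝ) - 1) * (p.2 : ℝ) * (c p.1 * c p.2) ∧
      ∑ p ∈ antidiagonal (m + 6), (2 * (p.1 : ℝ) - 1) * (p.2 : ℝ) * (c p.1 * c p.2) ≤
        (3 * (m : ℝ) + 25) * c (m + 5) := by
  have hsplit : ∑ p ∈ antidiagonal (m + 6), (2 * (p.1 : ℝ) - 1) * (p.2 : ℝ) * (c p.1 * c p.2) =
      (3 * (m : ℝ) + 14) * c (m + 5) + ∑ p ∈ antidiagonal (m + 2),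
        (2 * (p.1 : ℝ) + 3) * (p.2 + 2) * (c (p.1 + 2) * c (p.2 + 2)) := by
    rw [sum_antidiagonal_add_two _ (m + 4), sum_antidiagonal_add_two _ (m + 2)]
    simp only [hc.zero, zero_add, hc.one]
    push_cast
    have : ∀ p ∈ antidiagonal (m + 2), (2 * ((p.1 : ℝ) + 1 + 1) - 1) * ((p.2 : ℝ) + 1 + 1) *
        (c (p.1 + 1 + 1) * c (p.2 + 1 + 1)) =
        (2 * (p.1 : ℝ) + 3) * (p.2 + 2) * (c (p.1 + 2) * c (p.2 + 2)) := fun p _ => by ring_nf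
    rw [Finset.sum_congr rfl this]
    rw [show m + 2 + 1 + 1 + 1 = m + 5 from rfl, show m + 4 + 1 = m + 5 from rfl]
    ring
  have hnn : 0 ≤ ∑ p ∈ antidiagonal (m + 2),
      (2 * (p.1 : ℝ) + 3) * (p.2 + 2) * (c (p.1 + 2) * c (p.2 + 2)) :=
    Finset.sum_nonneg fun p _ => mul_nonneg (by positivity)
      (mul_nonneg (hc.nonneg _) (hc.nonneg _))
  -- The weights are absorbed into the indices by means of `2 * n * c n ≤ c (n + 1)`.
  have hle : ∑ p ∈ antidiagonal (m + 2),
      (2 * (p.1 : ℝ) + 3) * (p.2 + 2) * (c (p.1 + 2) * c (p.2 + 2)) ≤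
      ∑ p ∈ antidiagonal (m + 2), 1 / 2 * (c (p.1 + 3) * c (p.2 + 3)) := by
    refine Finset.sum_le_sum fun p _ => ?_
    have h1 := hc.two_mul_le (n := p.1 + 2) (by omega)
    have h2 := hc.two_mul_le (n := p.2 + 2) (by omega)
    have h3 := hc.nonneg (p.1 + 2)
    have h4 := hc.nonneg (p.2 + 2)
    push_cast at h1 h2
    have h5 : (2 * (p.1 : ℝ) + 3) * c (p.1 + 2) ≤ c (p.1 + 3) := by
      refine le_trans ?_ h1
      exact mul_le_mul_of_nonneg_right (by linarith) h3
    have h6 : ((p.2 : ℝ) + 2) * c (p.2 + 2) ≤ 1 / 2 * c (p.2 + 3) := by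
      rw [show p.2 + 3 = p.2 + 2 + 1 from rfl]
      linarith
    calc _ = ((2 * (p.1 : ℝ) + 3) * c (p.1 + 2)) * (((p.2 : ℝ) + 2) * c (p.2 + 2)) := by ring
      _ ≤ c (p.1 + 3) * (1 / 2 * c (p.2 + 3)) :=
          mul_le_mul h5 h6 (mul_nonneg (by positivity) h4) (hc.nonneg _)
      _ = _ := by ring
  have hup : ∑ p ∈ antidiagonal (m + 2), 1 / 2 * (c (p.1 + 3) * c (p.2 + 3)) ≤
      11 * c (m + 5) := by
    rw [← Finset.mul_sum, sum_antidiagonal_add_two]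
    simp only [zero_add, hc.three]
    have h1 := hc.sum_mul_le_of_upper (t := 4) (m := m) (by norm_num) fun a ha _ => hc.le_two_mul ha
    have h2 := hc.two_mul_le (n := m + 4) (by omega)
    have h3 := hc.nonneg (m + 4)
    rw [hc.four] at h1
    push_cast at h2
    rw [show m + 4 + 1 = m + 5 from rfl] at h2
    rw [show m + 2 + 3 = m + 5 from rfl]
    have h4 : ∑ p ∈ antidiagonal m, c (p.1 + 1 + 3) * c (p.2 + 1 + 3) =
        ∑ p ∈ antidiagonal m, c (p.1 + 4) * c (p.2 + 4) := rfl
    have h5 := hc.nonneg (m + 5)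
    rw [h4]
    linarith
  rw [hsplit]
  constructor <;> linarith

/-- On average the first component lacks `3 / 2` chords, up to `O(1 / n)`. -/
theorem abs_sub_drift_le (hc : IsConnectedCount c) {n : ℕ} (hn : 6 ≤ n) :
    |c n - 2 / 3 * ∑ p ∈ antidiagonal n, (2 * (p.1 : ℝ) - 1) * (p.2 : ℝ) * (c p.1 * c p.2)| ≤
      8 / n * c n := by
  obtain ⟨m, rfl⟩ := Nat.exists_eq_add_of_le' hn
  obtain ⟨h1, h2⟩ := hc.sum_drift_bounds m
  have h3 := hc.two_mul_le (n := m + 5) (by omega)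
  have h4 := hc.le_two_mul (n := m + 5) (by omega)
  have h5 := hc.nonneg (m + 5)
  rw [show m + 5 + 1 = m + 6 from rfl] at h3 h4
  have hm : (0 : ℝ) ≤ m := Nat.cast_nonneg m
  push_cast at *
  have h6 : 20 / 3 * c (m + 5) ≤ 8 / ((m : ℝ) + 6) * c (m + 6) := by
    rw [div_mul_eq_mul_div 8, le_div_iff₀ (by linarith)]
    have := mul_nonneg hm h5
    linarith
  rw [abs_le]
  constructor <;> linarith

end IsConnectedCount

/-! ### The expected index -/

/-- The recurrence for the total index forces its quotient with the number of diagrams to stay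
within `O(log n)` of `2 * n / 3`. -/
theorem IsConnectedCount.exists_abs_sub_le {c F : ℕ → ℝ} (hc : IsConnectedCount c) (hF0 : F 0 = 0)
    (hF : ∀ n, 2 ≤ n →
      F n = ∑ p ∈ antidiagonal n, (2 * (p.1 : ℝ) - 1) * ((F p.1 + c p.1) * c p.2)) :
    ∃ B : ℝ, ∀ n, |F n - 2 * n / 3 * c n| ≤ (B + 8 * (harmonic n : ℝ)) * c n := by
  have hmono : ∀ {m n : ℕ}, m ≤ n → (harmonic m : ℝ) ≤ harmonic n := by
    intro m n h
    have : harmonic m ≤ harmonic n :=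
      Finset.sum_le_sum_of_subset_of_nonneg (Finset.range_subset_range.2 h)
        fun _ _ _ => by positivity
    exact_mod_cast this
  refine ⟨∑ i ∈ Finset.range 6, |F i - 2 * i / 3 * c i| / c i, fun n => ?_⟩
  set B := ∑ i ∈ Finset.range 6, |F i - 2 * i / 3 * c i| / c i
  induction n using Nat.strong_induction_on with
  | _ n ih =>
    rcases Nat.eq_zero_or_pos n with h0 | hpos
    · simp [h0, hF0, hc.zero]
    have hcn := hc.pos hpos
    rcases Nat.lt_or_ge n 6 with h | h
    · rw [← div_le_iff₀ hcn]
      have h1 : |F n - 2 * n / 3 * c n| / c n ≤ B :=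
        Finset.single_le_sum (f := fun i : ℕ => |F i - 2 * i / 3 * c i| / c i)
          (fun i _ => div_nonneg (abs_nonneg _) (hc.nonneg i)) (Finset.mem_range.2 h)
      have h2 : (0 : ℝ) ≤ harmonic n := by simpa using hmono (Nat.zero_le n)
      linarith
    · -- The deviation satisfies the recurrence of `F`, with the drift error as inhomogeneity.
      have hdev : F n - 2 * n / 3 * c n =
          (c n - 2 / 3 * ∑ p ∈ antidiagonal n,
            (2 * (p.1 : ℝ) - 1) * (p.2 : ℝ) * (c p.1 * c p.2)) +
          ∑ p ∈ antidiagonal n,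
            (2 * (p.1 : ℝ) - 1) * ((F p.1 - 2 * p.1 / 3 * c p.1) * c p.2) := by
        have h1 : ((n : ℝ)) * c n = ∑ p ∈ antidiagonal n,
            (n : ℝ) * ((2 * (p.1 : ℝ) - 1) * (c p.1 * c p.2)) := by
          rw [← Finset.mul_sum, ← hc.rec_eq n (by omega)]
        have h2 : 2 * (n : ℝ) / 3 * c n = 2 / 3 * (n * c n) := by ring
        rw [h2, h1, hF n (by omega)]
        nth_rewrite 1 [hc.rec_eq n (by omega)]
        rw [Finset.mul_sum, Finset.mul_sum, ← Finset.sum_sub_distrib, ← Finset.sum_sub_distrib,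
          ← Finset.sum_add_distrib]
        refine Finset.sum_congr rfl fun p hp => ?_
        rw [mem_antidiagonal] at hp
        rw [← hp]
        push_cast
        ring
      have hsum : |∑ p ∈ antidiagonal n,
          (2 * (p.1 : ℝ) - 1) * ((F p.1 - 2 * p.1 / 3 * c p.1) * c p.2)| ≤
          (B + 8 * (harmonic (n - 1) : ℝ)) * c n := by
        nth_rewrite 1 [hc.rec_eq n (by omega)]
        rw [Finset.mul_sum]
        refine (Finset.abs_sum_le_sum_abs _ _).trans (Finset.sum_le_sum fun p hp => ?_)
        rw [mem_antidiagonal] at hp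
        rcases Nat.eq_zero_or_pos p.1 with h1 | h1
        · simp [h1, hF0, hc.zero]
        rcases Nat.eq_zero_or_pos p.2 with h2 | h2
        · simp [h2, hc.zero]
        have h3 : (0 : ℝ) ≤ 2 * (p.1 : ℝ) - 1 := by
          have : (1 : ℝ) ≤ p.1 := by exact_mod_cast h1
          linarith
        have h4 := ih p.1 (by omega)
        have h5 : |F p.1 - 2 * p.1 / 3 * c p.1| ≤ (B + 8 * (harmonic (n - 1) : ℝ)) * c p.1 := by
          refine h4.trans (mul_le_mul_of_nonneg_right ?_ (hc.nonneg _))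
          have := hmono (show p.1 ≤ n - 1 by omega)
          linarith
        rw [abs_mul, abs_mul, abs_of_nonneg h3, abs_of_nonneg (hc.nonneg p.2)]
        calc _ ≤ (2 * (p.1 : ℝ) - 1) * ((B + 8 * (harmonic (n - 1) : ℝ)) * c p.1 * c p.2) :=
              mul_le_mul_of_nonneg_left (mul_le_mul_of_nonneg_right h5 (hc.nonneg _)) h3
          _ = _ := by ring
      have hharm : (harmonic n : ℝ) = harmonic (n - 1) + 1 / n := by
        obtain ⟨m, rfl⟩ := Nat.exists_eq_add_of_le' hpos
        rw [Nat.add_sub_cancel, harmonic_succ]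
        push_cast
        rw [one_div]
      have hdrift := hc.abs_sub_drift_le h
      rw [hdev, hharm]
      refine (abs_add_le _ _).trans ((add_le_add hdrift hsum).trans_eq ?_)
      ring

theorem isConnectedCount_card :
    IsConnectedCount fun n => ((connectedChordDiagrams n).card : ℝ) := by
  refine ⟨by simp [connectedChordDiagrams_zero], by simp [connectedChordDiagrams_one],
    fun n hn => ?_⟩
  rw [card_connectedChordDiagrams hn]
  push_cast
  refine Finset.sum_congr rfl fun p _ => ?_
  rcases Nat.eq_zero_or_pos p.1 with h | h
  · simp [h, connectedChordDiagrams_zero]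
  · rw [Nat.cast_sub (by omega)]
    push_cast
    rfl

theorem exists_abs_expectedFirstTerminalIndex_sub_le :
    ∃ B : ℝ, ∀ n : ℕ, 1 ≤ n →
      |expectedFirstTerminalIndex n - 2 * n / 3| ≤ B + 8 * (harmonic n : ℝ) := by
  have hc := isConnectedCount_card
  obtain ⟨B, hB⟩ := hc.exists_abs_sub_le (F := fun n => (totalIndex n : ℝ))
    (by simp [totalIndex, connectedChordDiagrams_zero]) (fun n hn => by
      simp only [totalIndex_eq hn]
      push_cast
      refine Finset.sum_congr rfl fun p _ => ?_
      rcases Nat.eq_zero_or_pos p.1 with h | h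
      · simp [h, totalIndex, connectedChordDiagrams_zero]
      · rw [Nat.cast_sub (by omega)]
        push_cast
        rfl)
  refine ⟨B, fun n hn => ?_⟩
  have hpos := hc.pos hn
  have h1 : expectedFirstTerminalIndex n - 2 * n / 3 =
      ((totalIndex n : ℝ) - 2 * n / 3 * (connectedChordDiagrams n).card) /
        (connectedChordDiagrams n).card := by
    rw [sub_div, mul_div_cancel_right₀ _ hpos.ne', expectedFirstTerminalIndex, totalIndex]
    push_cast
    rfl
  rw [h1, abs_div, abs_of_pos hpos, div_le_iff₀ hpos]
  exact hB n

end ChordDiagrams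

theorem mainTheorem4 :
    Asymptotics.IsEquivalent Filter.atTop
      (fun n : ℕ => ChordDiagrams.expectedFirstTerminalIndex n)
      (fun n : ℕ => 2 * (n : ℝ) / 3) := by
  obtain ⟨B, hB⟩ := ChordDiagrams.exists_abs_expectedFirstTerminalIndex_sub_le
  have hlog : (fun n : ℕ => Real.log n) =o[Filter.atTop] fun n : ℕ => (n : ℝ) :=
    Real.isLittleO_log_id_atTop.comp_tendsto tendsto_natCast_atTop_atTop
  have hconst : (fun _ : ℕ => B + 8) =o[Filter.atTop] fun n : ℕ => (n : ℝ) :=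
    (Asymptotics.isLittleO_const_id_atTop (B + 8)).comp_tendsto tendsto_natCast_atTop_atTop
  have hbound : (fun n : ℕ => (B + 8) + 8 * Real.log n) =o[Filter.atTop]
      fun n : ℕ => 2 * (n : ℝ) / 3 := by
    refine (hconst.add (hlog.const_mul_left 8)).trans_isBigO ?_
    refine Asymptotics.IsBigO.of_bound 2 (Filter.Eventually.of_forall fun n => ?_)
    rw [Real.norm_of_nonneg (by positivity), Real.norm_of_nonneg (by positivity)]
    have : (0 : ℝ) ≤ n := Nat.cast_nonneg n
    linarith
  refine Asymptotics.IsBigO.trans_isLittleO (Asymptotics.IsBigO.of_bound 1 ?_) hbound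
  filter_upwards [Filter.eventually_ge_atTop 1] with n hn
  have h1 := hB n hn
  have h2 := harmonic_le_one_add_log n
  rw [one_mul, Pi.sub_apply, Real.norm_eq_abs, Real.norm_eq_abs]
  refine le_trans ?_ (le_abs_self _)
  linarith
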